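/- Let $q\in(0,1)$ and let $d\ge 1$ be an integer. Let $\Omega$ be the set of $\eta\in\{0,1\}^{\mathbb Z}$ with finitely many particles ($\eta_i=1$) on $(-\infty,0]$ and finitely many holes ($\eta_i=0$) on $[1,\infty)$, and let $Z_+^d=\{x\in\mathbb Z^d: 0\le x_1<\dots<x_d\}$. The label of a particle of $\eta\in\Omega$ is the number of particles to its left. Let $(\xi(t),x(t))_{t\ge0}$ be the continuous-time Markov chain on the countable set $\Omega\times Z_+^d$ with the following jumps. (i) $\xi$ evolves as the ASEP: over each edge $(j,j+1)$ of $\mathbb Z$ a particle jumps right at rate $1$ and left at rate $q$ if the target site is empty; $x$ does not change at these jumps. (ii) $x(t)$ lists the occupied sites of an exclusion process with $d$ particles on $\mathbb Z_{\ge0}$ (closed boundary at $0$): over each edge $(i,i+1)$ a particle jumps right at rate $q$ and left at rate $1$ if the target site is empty and if moreover the particles of $\xi(t)$ with labels $i$ and $i+1$ are at neighbouring sites. (Thus $x(t)$ is the process of the labels of the $d$ second-class particles.) Put $$\pi(x)=\prod_{i=1}^d(1-q^i)\cdot q^{\sum_{i=1}^d x_i-\frac{d(d-1)}2},\qquad x\in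 Z_+^d .$$ **Theorem.** The chain $(\xi(t),x(t))$ is non-explosive, $\pi$ is a probability distribution on $Z_+^d$, and $\pi$ is a reversible stationary distribution of the label process, whatever the background $\xi$, in the following sense. (a) For each fixed $\eta\in\Omega$, $\pi$ is a reversible stationary distribution of the Markov chain on $Z_+^d$ that jumps at the rates (ii) with $\xi(t)$ frozen at $\eta$. (b) Let $\xi(0)$ have an arbitrary distribution $\rho$ on $\Omega$, and let $x(0)\sim\pi$ be independent of $\xi(0)$. Then, for every $t\ge0$, $x(t)\sim\pi$ and $x(t)$ is independent of the whole process $(\xi(s))_{s\ge0}$. (c) If moreover $\rho$ satisfies detailed balance with respect to the ASEP rates, then $(x(t))_{t\ge0}$ is a stationary process whose law on each $[0,T]$ is invariant under time reversal; the same holds for the pair $(\xi(t),x(t))_{t\ge0}$. For every $c\in\mathbb R$ the blocking measure $$\mu^c(\eta)=\prod_{i\in\mathbb Z}\frac{q^{-(i-c)\eta_i}}{1+q^{-(i-c)}}$$ satisfies these detailed balance equations. -/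

import Mathlib

open MeasureTheory ProbabilityTheory
open scoped ENNReal NNReal

/-! ### Continuous-time Markov chains with given jump rates -/

section MarkovChain

variable {S : Type*}

/-- Total jump rate out of `x`. (`r x y` is the rate of the jump from `x` to `y`; all the rate functions
below satisfy `r x x = 0` and have finite total rates.) -/
noncomputable def exitRate (r : S → S → ℝ≥0∞) (x : S) : ℝ≥0∞ := ∑' y, r x y

/-- Probability that the chain started at `x` does not jump before time `t`. -/
noncomputable def holdProb (r : S → S → ℝ≥0∞) (x : S) (t : ℝ) : ℝ≥0∞ :=
  ENNReal.ofReal (Real.exp (-((exitRate r x).toReal * t)))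

open Classical in
/-- Probability that the chain started at `x` is at `y` at time `t`, having made at most `n` jumps
(conditioning on the time `s` and the target `z` of the first jump). -/
noncomputable def transProbUpTo (r : S → S → ℝ≥0∞) : ℕ → ℝ → S → S → ℝ≥0∞
  | 0, t, x, y => if x = y then holdProb r x t else 0
  | n + 1, t, x, y => (if x = y then holdProb r x t else 0) +
      ∫⁻ s in Set.Ioc 0 t, holdProb r x s * ∑' z, r x z * transProbUpTo r n (t - s) z y

/-- The (minimal) transition function of the continuous-time Markov chain with jump rates `r`. -/
noncomputable def transProb (r : S → S → ℝ≥0∞) (t : ℝ) (x y : S) : ℝ≥0∞ :=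
  ⨆ n, transProbUpTo r n t x y

/-- Detailed balance of the weights `m` with respect to the rates `r`. -/
def DetailedBalance (r : S → S → ℝ≥0∞) (m : S → ℝ≥0∞) : Prop :=
  ∀ x y, m x * r x y = m y * r y x

/-- `m` is a reversible stationary probability distribution of the Markov chain with rates `r`. -/
structure IsReversibleStationary (r : S → S → ℝ≥0∞) (m : S → ℝ≥0∞) : Prop where
  total : ∑' x, m x = 1
  stationary : ∀ t : ℝ, 0 ≤ t → ∀ y, ∑' x, m x * transProb r t x y = m y
  reversible : ∀ t : ℝ, 0 ≤ t → ∀ x y, m x * transProb r t x y = m y * transProb r t y x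

/-- `Z` is a continuous-time Markov chain with jump rates `r` and initial distribution `m`: its
finite-dimensional distributions are those given by `m` and the transition function. -/
structure IsMarkovChain [MeasurableSpace S] {Ω' : Type*} [MeasurableSpace Ω'] (P : Measure Ω')
    (r : S → S → ℝ≥0∞) (m : S → ℝ≥0∞) (Z : ℝ≥0 → Ω' → S) : Prop where
  measurable : ∀ t, Measurable (Z t)
  fdd : ∀ (n : ℕ) (t : Fin (n + 1) → ℝ≥0) (z : Fin (n + 1) → S), t 0 = 0 → Monotone t →
    P {ω | ∀ i, Z (t i) ω = z i} =
      m (z 0) * ∏ i : Fin n,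
        transProb r ((t i.succ : ℝ) - (t i.castSucc : ℝ)) (z i.castSucc) (z i.succ)

/-- Strict stationarity of a process: its law is invariant under time shifts. -/
def IsStationaryProcess [MeasurableSpace S] {Ω' : Type*} [MeasurableSpace Ω'] (P : Measure Ω')
    (X : ℝ≥0 → Ω' → S) : Prop :=
  ∀ s : ℝ≥0, IdentDistrib (fun ω (t : ℝ≥0) => X (s + t) ω) (fun ω (t : ℝ≥0) => X t ω) P P

/-- Reversibility of a process: on every `[0, T]` its law is invariant under time reversal. -/
def IsReversibleProcess [MeasurableSpace S] {Ω' : Type*} [MeasurableSpace Ω'] (P : Measure Ω')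
    (X : ℝ≥0 → Ω' → S) : Prop :=
  ∀ T : ℝ≥0, IdentDistrib (fun ω (t : Set.Iic T) => X (T - (t : ℝ≥0)) ω)
    (fun ω (t : Set.Iic T) => X (t : ℝ≥0) ω) P P

end MarkovChain

/-! ### The ASEP on `ℤ` -/

/-- The state space of the ASEP: particle configurations on `ℤ` (`true` is a particle, `false` a hole)
with finitely many particles on `(-∞, 0]` and finitely many holes on `[1, ∞)`. -/
abbrev AsepState : Type :=
  {η : ℤ → Bool // {i : ℤ | i ≤ 0 ∧ η i = true}.Finite ∧ {i : ℤ | 1 ≤ i ∧ η i = false}.Finite}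

open Classical in
/-- Jump rates of the ASEP: over each edge `(j, j+1)` a particle jumps right at rate `1` and left at
rate `q`, subject to exclusion. -/
noncomputable def asepRate (q : ℝ) (η η' : AsepState) : ℝ≥0∞ :=
  ∑' j : ℤ, if η'.1 = η.1 ∘ Equiv.swap j (j + 1) then
    (if η.1 j = true ∧ η.1 (j + 1) = false then 1
      else if η.1 j = false ∧ η.1 (j + 1) = true then ENNReal.ofReal q else 0)
  else 0

/-- The one-site marginal `μ_i^c(z) = q^{-(i-c)z} / (1 + q^{-(i-c)})`, `z ∈ {0, 1}`. -/
noncomputable def blockingMarginal (q c : ℝ) (i : ℤ) (b : Bool) : ℝ :=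
  q ^ (-((i : ℝ) - c) * (b.toNat : ℝ)) / (1 + q ^ (-((i : ℝ) - c)))

/-- The product blocking measure `μ^c`, as a weight on configurations. -/
noncomputable def blockingMeasure (q c : ℝ) (η : AsepState) : ℝ≥0∞ :=
  ENNReal.ofReal (∏' i : ℤ, blockingMarginal q c i (η.1 i))

/-! ### The label process -/

/-- The state space `Z_+^d = {0 ≤ x_1 < x_2 < ⋯ < x_d}`. -/
abbrev LabelState (d : ℕ) : Type := {x : Fin d → ℕ // StrictMono x}

/-- The particles of `η` with labels `i` and `i + 1` sit at neighbouring sites `j` and `j + 1`; the label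
of a particle is the number of particles to its left. -/
def LabelsAdjacent (η : AsepState) (i : ℕ) : Prop :=
  ∃ j : ℤ, η.1 j = true ∧ η.1 (j + 1) = true ∧ {k : ℤ | k < j ∧ η.1 k = true}.ncard = i

open Classical in
/-- Jump rates of the label process while the background is in state `η`: in the exclusion process on
`ℤ_{≥0}` with particles at `x_1 < ⋯ < x_d`, a particle crosses the edge `(i, i+1)` rightwards at rate `q`
and leftwards at rate `1`, provided that the particles of `η` with labels `i` and `i+1` are neighbours.
The exclusion rule and the closed boundary at `0` hold because `x, x' ∈ Z_+^d`. -/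
noncomputable def labelRate (q : ℝ) {d : ℕ} (η : AsepState) (x x' : LabelState d) : ℝ≥0∞ :=
  ∑ k : Fin d,
    ((if x'.1 = x.1 + Pi.single k 1 ∧ LabelsAdjacent η (x.1 k) then ENNReal.ofReal q else 0) +
      (if x.1 = x'.1 + Pi.single k 1 ∧ LabelsAdjacent η (x'.1 k) then 1 else 0))

open Classical in
/-- Jump rates of the pair `(ξ(t), x(t))`: `ξ` is an autonomous ASEP, and `x` jumps at the rates that
the current state of `ξ` prescribes. -/
noncomputable def jointRate (q : ℝ) (d : ℕ) (z z' : AsepState × LabelState d) : ℝ≥0∞ :=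
  (if z.2 = z'.2 then asepRate q z.1 z'.1 else 0) +
    (if z.1 = z'.1 then labelRate q z.1 z.2 z'.2 else 0)

/-- `π(x) = ∏_{i=1}^d (1 - q^i) · q^{∑ x_i - d(d-1)/2}`. -/
noncomputable def labelDist (q : ℝ) (d : ℕ) (x : LabelState d) : ℝ≥0∞ :=
  ENNReal.ofReal ((∏ i ∈ Finset.Icc 1 d, (1 - q ^ i)) *
    q ^ ((∑ i, (x.1 i : ℝ)) - (d : ℝ) * ((d : ℝ) - 1) / 2))

/-! ### Convolution of functions on `ℝ` vanishing on the negative half-line -/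

section Convolution

/-! The rates with which labels cross the edge `(i, i+1)` are `q` and `1` or both zero, and whether
the edge is open depends on the background alone. As `π` gains a factor `q` when one label moves
right, it is reversible whatever edges are open (`detailedBalance_labelRate`). Background and label
moves change different coordinates, so `m ⊗ π` satisfies detailed balance for the joint rates
whenever `m` does for the ASEP (`DetailedBalance.jointRate`).

Three facts carry this from rates to transition probabilities `p_t`. Detailed balance passes to the
minimal transition function by reversing paths (`DetailedBalance.mul_upToFun`). The chain does not
explode, by comparison with a Yule process (`tsum_transProb_eq_one`). Hence the background is an
ASEP with transition function `P_t`, for any initial label (`tsum_transProb_fiber`).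

For an arbitrary initial law, a blocking measure `μ` serves as an auxiliary weight: `μ(η) ∑_x π(x)
p_t((η,x),(η',x')) = μ(η') π(x') ∑_x p_t((η',x'),(η,x)) = μ(η') π(x') P_t(η',η) = μ(η) P_t(η,η')
π(x')`. Cancelling `μ(η) > 0` shows that `π` is kept through a time step, given both background
endpoints (`tsum_labelDist_mul_transProb`). Iterating this over finitely many times
(`tsum_mul_prod_eq`) gives the independence. For a reversible initial law, the joint chain itself is
reversible and stationary, and the labels inherit this by projection. -/

lemma lconvolution_eq_setLIntegral {f g : ℝ → ℝ≥0∞} (hf : ∀ t < 0, f t = 0)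
    (hg : ∀ t < 0, g t = 0) (t : ℝ) :
    (f ⋆ₗ g) t = ∫⁻ s in Set.Ioc 0 t, f s * g (t - s) := by
  -- The convolution integrand may be nonzero at `s = 0`, so its natural support is the closed
  -- interval, which differs by a null set.
  rw [setLIntegral_congr (Ioc_ae_eq_Icc (μ := volume) (a := (0 : ℝ)) (b := t)),
    ← lintegral_indicator measurableSet_Icc, lconvolution_def]
  congr 1
  funext s
  by_cases hs : s ∈ Set.Icc 0 t
  · rw [Set.indicator_of_mem hs, neg_add_eq_sub]
  · rw [Set.indicator_of_notMem hs]
    rw [Set.mem_Icc, not_and_or, not_le, not_le] at hs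
    rcases hs with hs | hs
    · rw [hf s hs, zero_mul]
    · rw [hg _ (by linarith), mul_zero]

lemma lconvolution_tsum_right {ι : Type*} [Countable ι] {f : ℝ → ℝ≥0∞} {g : ι → ℝ → ℝ≥0∞}
    (hf : Measurable f) (hg : ∀ i, Measurable (g i)) (t : ℝ) :
    (f ⋆ₗ fun u => ∑' i, g i u) t = ∑' i, (f ⋆ₗ g i) t := by
  simp only [lconvolution_def, ← ENNReal.tsum_mul_left]
  exact lintegral_tsum fun i => by have := hg i; fun_prop

lemma lconvolution_add_right {f g h : ℝ → ℝ≥0∞}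
    (hf : Measurable f) (hg : Measurable g) (t : ℝ) :
    (f ⋆ₗ fun u => g u + h u) t = (f ⋆ₗ g) t + (f ⋆ₗ h) t := by
  simp only [lconvolution_def, mul_add]
  exact lintegral_add_left (by fun_prop) _

lemma lconvolution_const_mul_right {f g : ℝ → ℝ≥0∞} (c : ℝ≥0∞)
    (hf : Measurable f) (hg : Measurable g) (t : ℝ) :
    (f ⋆ₗ fun u => c * g u) t = c * (f ⋆ₗ g) t := by
  simp only [lconvolution_def, mul_left_comm _ c]
  exact lintegral_const_mul _ (by fun_prop)

lemma lconvolution_tsum_const_mul_right {ι : Type*} [Countable ι] {f : ℝ → ℝ≥0∞} (hf : Measurable f)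
    (c : ι → ℝ≥0∞) {g : ι → ℝ → ℝ≥0∞} (hg : ∀ z, Measurable (g z)) (t : ℝ) :
    (f ⋆ₗ fun u => ∑' z, c z * g z u) t = ∑' z, c z * (f ⋆ₗ g z) t := by
  rw [lconvolution_tsum_right hf (fun z => (hg z).const_mul _)]
  simp only [lconvolution_const_mul_right _ hf (hg _)]

lemma lconvolution_zero_right (f : ℝ → ℝ≥0∞) (t : ℝ) : (f ⋆ₗ fun _ => 0) t = 0 := by
  simp [lconvolution_def]

lemma lconvolution_mono_right {f g h : ℝ → ℝ≥0∞} (hgh : ∀ t, g t ≤ h t) (t : ℝ) :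
    (f ⋆ₗ g) t ≤ (f ⋆ₗ h) t :=
  lintegral_mono fun _ => mul_le_mul_right (hgh _) _

lemma lconvolution_iSup_right {f : ℝ → ℝ≥0∞} {g : ℕ → ℝ → ℝ≥0∞}
    (hf : Measurable f) (hg : ∀ i, Measurable (g i)) (hm : ∀ u, Monotone fun n => g n u) (t : ℝ) :
    (f ⋆ₗ fun u => ⨆ i, g i u) t = ⨆ i, (f ⋆ₗ g i) t := by
  simp only [lconvolution_def, ENNReal.mul_iSup]
  exact lintegral_iSup (fun i => by have := hg i; fun_prop)
    fun i j hij s => mul_le_mul_right (hm _ hij) _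

lemma ENNReal.tsum_iSup_of_monotone {ι : Type*} {f : ℕ → ι → ℝ≥0∞}
    (hm : ∀ i, Monotone fun n => f n i) : ∑' i, ⨆ n, f n i = ⨆ n, ∑' i, f n i := by
  let _ : MeasurableSpace ι := ⊤
  simp only [← lintegral_count]
  exact lintegral_iSup (fun _ => measurable_from_top) fun i j hij s => hm s hij

/-- An exponential clock of rate `b` has either rung by time `t` or not. -/
lemma mul_setLIntegral_exp_add {b t : ℝ} (hb : 0 ≤ b) (ht : 0 ≤ t) :
    ENNReal.ofReal b * (∫⁻ s in Set.Ioc 0 t, ENNReal.ofReal (Real.exp (-(b * s)))) +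
      ENNReal.ofReal (Real.exp (-(b * t))) = 1 := by
  have hint : IntervalIntegrable (fun s => b * Real.exp (-(b * s))) volume 0 t :=
    (by fun_prop : Continuous fun s => b * Real.exp (-(b * s))).intervalIntegrable _ _
  have hI : ∫ s in (0 : ℝ)..t, b * Real.exp (-(b * s)) = 1 - Real.exp (-(b * t)) := by
    rw [intervalIntegral.integral_eq_sub_of_hasDerivAt (f := fun s => -Real.exp (-(b * s)))
      _ hint]
    · simp; ring
    · intro s _
      have := (((hasDerivAt_id s).const_mul b).neg.exp).neg
      convert this using 1
      · rfl
      · simp [mul_comm]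
  rw [← lintegral_const_mul _ (by fun_prop)]
  simp only [← ENNReal.ofReal_mul hb]
  rw [← ofReal_integral_eq_lintegral_ofReal, ← intervalIntegral.integral_of_le ht, hI,
    ← ENNReal.ofReal_add]
  · simp
  · rw [sub_nonneg]; apply Real.exp_le_one_iff.2; nlinarith [mul_nonneg hb ht]
  · positivity
  · exact (intervalIntegrable_iff_integrableOn_Ioc_of_le ht).1 hint
  · exact Filter.Eventually.of_forall fun s => by positivity

end Convolution

/-! ### The minimal transition function -/

section TransitionFunction

variable {S : Type*}

/-- `holdProb`, extended by zero to negative times. -/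
noncomputable def holdFun (r : S → S → ℝ≥0∞) (x : S) (t : ℝ) : ℝ≥0∞ :=
  if 0 ≤ t then holdProb r x t else 0

open Classical in
/-- The transition function of the chain that never jumps. -/
noncomputable def stayFun (r : S → S → ℝ≥0∞) (x y : S) (t : ℝ) : ℝ≥0∞ :=
  if x = y then holdFun r x t else 0

/-- `transProbUpTo`, extended by zero to negative times. -/
noncomputable def upToFun (r : S → S → ℝ≥0∞) (n : ℕ) (x y : S) (t : ℝ) : ℝ≥0∞ :=
  if 0 ≤ t then transProbUpTo r n t x y else 0

/-- `transProb`, extended by zero to negative times. -/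
noncomputable def transFun (r : S → S → ℝ≥0∞) (x y : S) (t : ℝ) : ℝ≥0∞ :=
  ⨆ n, upToFun r n x y t

variable (r : S → S → ℝ≥0∞)

lemma holdFun_of_neg (x : S) {t : ℝ} (ht : t < 0) : holdFun r x t = 0 := if_neg ht.not_ge

lemma holdFun_of_nonneg (x : S) {t : ℝ} (ht : 0 ≤ t) : holdFun r x t = holdProb r x t := if_pos ht

lemma upToFun_of_neg (n : ℕ) (x y : S) {t : ℝ} (ht : t < 0) : upToFun r n x y t = 0 :=
  if_neg ht.not_ge

@[fun_prop]
lemma measurable_holdFun (x : S) : Measurable (holdFun r x) := by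
  unfold holdFun holdProb
  exact Measurable.ite measurableSet_Ici (by fun_prop) measurable_const

@[fun_prop]
lemma measurable_stayFun (x y : S) : Measurable (stayFun r x y) := by
  unfold stayFun
  split_ifs
  · fun_prop
  · exact measurable_const

lemma upToFun_zero (x y : S) : upToFun r 0 x y = stayFun r x y := by
  funext t
  unfold upToFun stayFun holdFun transProbUpTo
  split_ifs <;> rfl

/-- Extension by zero turns the first-jump recursion into a convolution on `ℝ`, which makes
commutativity and associativity available. -/
lemma upToFun_succ_eq (n : ℕ) (x y : S) (t : ℝ) : upToFun r (n + 1) x y t = stayFun r x y t +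
    (holdFun r x ⋆ₗ fun u => ∑' z, r x z * upToFun r n z y u) t := by
  rw [lconvolution_eq_setLIntegral (fun u hu => holdFun_of_neg r x hu)
    (fun u hu => by simp [upToFun_of_neg r n _ y hu])]
  by_cases ht : 0 ≤ t
  · rw [upToFun, if_pos ht, transProbUpTo, stayFun, holdFun_of_nonneg r x ht]
    congr 1
    refine setLIntegral_congr_fun measurableSet_Ioc fun s hs => ?_
    simp only [holdFun_of_nonneg r x hs.1.le, upToFun, if_pos (sub_nonneg.2 hs.2)]
  · rw [upToFun, if_neg ht, Set.Ioc_eq_empty (fun h => ht h.le), stayFun, holdFun, if_neg ht]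
    simp

/-- With exactly one jump, the first jump is the last: only `z = y` survives on the left and only `z
= x` on the right. -/
lemma tsum_mul_lconvolution_stayFun (x y : S) (t : ℝ) :
    ∑' z, r x z * (holdFun r x ⋆ₗ stayFun r z y) t =
      ∑' z, r z y * (stayFun r x z ⋆ₗ holdFun r y) t := by
  rw [tsum_eq_single y, tsum_eq_single x]
  · rw [show stayFun r y y = holdFun r y from funext fun _ => if_pos rfl,
      show stayFun r x x = holdFun r x from funext fun _ => if_pos rfl]
  · intro z hz
    rw [show stayFun r x z = fun _ => 0 from funext fun _ => if_neg hz.symm, lconvolution_comm,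
      lconvolution_zero_right, mul_zero]
  · intro z hz
    rw [show stayFun r z y = fun _ => 0 from funext fun _ => if_neg hz,
      lconvolution_zero_right, mul_zero]

variable {r} in
lemma transProb_eq_transFun {t : ℝ} (ht : 0 ≤ t) (x y : S) :
    transProb r t x y = transFun r x y t := by
  simp [transProb, transFun, upToFun, if_pos ht]

variable [Countable S]

@[fun_prop]
lemma measurable_upToFun (n : ℕ) (x y : S) : Measurable (upToFun r n x y) := by
  induction n generalizing x y with
  | zero => rw [upToFun_zero]; fun_prop
  | succ n ih =>
    rw [funext (upToFun_succ_eq r n x y)]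
    exact (measurable_stayFun r x y).add (measurable_lconvolution _ (measurable_holdFun r x)
      (Measurable.tsum fun z => (ih z y).const_mul _))

/-- Decomposition at the first jump. -/
lemma upToFun_succ (n : ℕ) (x y : S) (t : ℝ) : upToFun r (n + 1) x y t = stayFun r x y t +
    ∑' z, r x z * (holdFun r x ⋆ₗ upToFun r n z y) t := by
  rw [upToFun_succ_eq, lconvolution_tsum_const_mul_right (by fun_prop) _ (by fun_prop)]

/-- Decomposition at the last jump. -/
lemma upToFun_succ' (n : ℕ) (x y : S) (t : ℝ) : upToFun r (n + 1) x y t = stayFun r x y t +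
    ∑' z, r z y * (upToFun r n x z ⋆ₗ holdFun r y) t := by
  induction n generalizing x y t with
  | zero =>
    rw [upToFun_succ]
    simp only [upToFun_zero]
    rw [tsum_mul_lconvolution_stayFun]
  | succ n ih =>
    -- Paths with at least two jumps are split at both their first jump `x → z` and their last jump
    -- `w → y`, in either order; associativity of convolution identifies the two double sums.
    have hl : ∀ z, (holdFun r x ⋆ₗ upToFun r (n + 1) z y) t =
        (holdFun r x ⋆ₗ stayFun r z y) t +
          ∑' w, r w y * (holdFun r x ⋆ₗ (upToFun r n z w ⋆ₗ holdFun r y)) t := by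
      intro z
      rw [funext (ih z y), lconvolution_add_right (by fun_prop) (by fun_prop),
        lconvolution_tsum_const_mul_right (by fun_prop) _ (by fun_prop)]
    have hr : ∀ w, (upToFun r (n + 1) x w ⋆ₗ holdFun r y) t =
        (stayFun r x w ⋆ₗ holdFun r y) t +
          ∑' z, r x z * ((holdFun r x ⋆ₗ upToFun r n z w) ⋆ₗ holdFun r y) t := by
      intro w
      rw [lconvolution_comm, funext (upToFun_succ r n x w),
        lconvolution_add_right (by fun_prop) (by fun_prop),
        lconvolution_tsum_const_mul_right (by fun_prop) _ (by fun_prop), lconvolution_comm]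
      simp only [lconvolution_comm (f := holdFun r y)]
    rw [upToFun_succ]
    simp only [hl, hr, mul_add, ENNReal.tsum_add, tsum_mul_lconvolution_stayFun,
      ← ENNReal.tsum_mul_left]
    rw [ENNReal.tsum_comm]
    congr 2
    refine tsum_congr fun w => tsum_congr fun z => ?_
    rw [lconvolution_assoc (by fun_prop) (by fun_prop) (by fun_prop), mul_left_comm]

variable {r}

/-- Path reversal: the first jump from `x` to `y` is the last jump of the reversed path. Detailed
balance carries the weight across that jump, and the induction hypothesis across the rest. -/
lemma DetailedBalance.mul_upToFun {m : S → ℝ≥0∞} (h : DetailedBalance r m) (n : ℕ) (x y : S) (t : ℝ) :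
    m x * upToFun r n x y t = m y * upToFun r n y x t := by
  have h0 : ∀ x y t, m x * stayFun r x y t = m y * stayFun r y x t := by
    intro x y t
    by_cases hxy : x = y
    · rw [hxy]
    · rw [stayFun, stayFun, if_neg hxy, if_neg (Ne.symm hxy), mul_zero, mul_zero]
  induction n generalizing x y t with
  | zero => rw [upToFun_zero, upToFun_zero, h0]
  | succ n ih =>
    rw [upToFun_succ, upToFun_succ', mul_add, mul_add, h0, ← ENNReal.tsum_mul_left,
      ← ENNReal.tsum_mul_left]
    congr! 3 with z
    have ih' : (fun u => m z * upToFun r n z y u) =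
        fun u => m y * upToFun r n y z u := funext fun u => ih z y u
    rw [← mul_assoc, h x z, mul_comm (m z), mul_assoc,
      ← lconvolution_const_mul_right _ (by fun_prop) (by fun_prop), ih',
      lconvolution_const_mul_right _ (by fun_prop) (by fun_prop), lconvolution_comm, mul_left_comm]

lemma DetailedBalance.mul_transProb {m : S → ℝ≥0∞} (h : DetailedBalance r m) {t : ℝ} (ht : 0 ≤ t)
    (x y : S) : m x * transProb r t x y = m y * transProb r t y x := by
  simp only [transProb_eq_transFun ht, transFun, ENNReal.mul_iSup, h.mul_upToFun]

lemma monotone_upToFun (x y : S) (t : ℝ) : Monotone fun n => upToFun r n x y t := by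
  refine monotone_nat_of_le_succ fun n => ?_
  induction n generalizing x y t with
  | zero => rw [upToFun_zero, upToFun_succ]; exact le_self_add
  | succ n ih =>
    rw [upToFun_succ, upToFun_succ r (n + 1)]
    exact add_le_add_right (ENNReal.tsum_le_tsum fun z => mul_le_mul_right
      (lconvolution_mono_right (fun u => ih z y u) t) _) _

@[fun_prop]
lemma measurable_transFun (x y : S) : Measurable (transFun r x y) :=
  Measurable.iSup fun n => measurable_upToFun r n x y

/-- The backward equation, in integrated form. -/
lemma transFun_eq (x y : S) (t : ℝ) : transFun r x y t = stayFun r x y t +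
    ∑' z, r x z * (holdFun r x ⋆ₗ transFun r z y) t := by
  have h1 : transFun r x y t = ⨆ n, upToFun r (n + 1) x y t :=
    ((monotone_upToFun x y t).iSup_nat_add 1).symm
  have h2 : ∀ z, (holdFun r x ⋆ₗ transFun r z y) t = ⨆ n, (holdFun r x ⋆ₗ upToFun r n z y) t :=
    fun z => lconvolution_iSup_right (by fun_prop) (by fun_prop) (fun u => monotone_upToFun z y u) t
  rw [h1]
  simp only [upToFun_succ, h2, ENNReal.mul_iSup]
  rw [← ENNReal.add_iSup, ENNReal.tsum_iSup_of_monotone]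
  intro z n n' hn
  exact mul_le_mul_right (lconvolution_mono_right (fun u => monotone_upToFun z y u hn) t) _

end TransitionFunction

/-! ### Total mass of the transition function -/

section Mass

variable {S : Type*} {r : S → S → ℝ≥0∞}

/-- Finiteness matters: for an infinite exit rate `toReal` is `0` and `holdProb` would be `1`. -/
lemma holdFun_add_exitRate_mul_lintegral {x : S} (hx : exitRate r x ≠ ∞) {t : ℝ} (ht : 0 ≤ t) :
    holdFun r x t + exitRate r x * (∫⁻ s in Set.Ioc 0 t, holdFun r x s) = 1 := by
  rw [← mul_setLIntegral_exp_add (b := (exitRate r x).toReal) ENNReal.toReal_nonneg ht, add_comm,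
    ENNReal.ofReal_toReal hx, holdFun_of_nonneg r x ht, holdProb]
  congr 2
  refine setLIntegral_congr_fun measurableSet_Ioc fun s hs => ?_
  simp only [holdFun_of_nonneg r x hs.1.le, holdProb]

lemma tsum_stayFun (x : S) (t : ℝ) : ∑' y, stayFun r x y t = holdFun r x t := by
  rw [tsum_eq_single x]
  · exact if_pos rfl
  · exact fun y hy => if_neg hy.symm

variable [Countable S]

lemma tsum_upToFun_succ (n : ℕ) (x : S) (t : ℝ) :
    ∑' y, upToFun r (n + 1) x y t = holdFun r x t +
      ∫⁻ s in Set.Ioc 0 t, holdFun r x s * ∑' z, r x z * ∑' y, upToFun r n z y (t - s) := by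
  simp only [upToFun_succ_eq, ENNReal.tsum_add, tsum_stayFun]
  congr 1
  rw [← lconvolution_tsum_right (by fun_prop)
    (fun y => Measurable.tsum fun z => (measurable_upToFun r n z y).const_mul _),
    lconvolution_eq_setLIntegral (fun u hu => holdFun_of_neg r x hu)
      (fun u hu => by simp [upToFun_of_neg r n _ _ hu])]
  refine lintegral_congr fun s => ?_
  rw [ENNReal.tsum_comm]
  simp only [ENNReal.tsum_mul_left]

lemma tsum_upToFun_le_one (hr : ∀ x, exitRate r x ≠ ∞) (n : ℕ) (x : S) (t : ℝ) :
    ∑' y, upToFun r n x y t ≤ 1 := by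
  rcases lt_or_ge t 0 with ht | ht
  · simp [upToFun_of_neg r n _ _ ht]
  have h1 := holdFun_add_exitRate_mul_lintegral (hr x) ht
  induction n generalizing x t with
  | zero =>
    simp only [upToFun_zero, tsum_stayFun]
    rw [← h1]
    exact le_self_add
  | succ n ih =>
    rw [tsum_upToFun_succ n x t, ← h1, mul_comm, ← lintegral_mul_const _ (by fun_prop)]
    refine add_le_add_right (setLIntegral_mono (by fun_prop) fun s hs => ?_) _
    refine mul_le_mul_right (ENNReal.tsum_le_tsum fun z => ?_) _
    exact mul_le_of_le_one_right' (ih z (t - s) (sub_nonneg.2 hs.2)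
      (holdFun_add_exitRate_mul_lintegral (hr z) (sub_nonneg.2 hs.2)))

lemma tsum_transProb_eq_iSup (x : S) {t : ℝ} (ht : 0 ≤ t) :
    ∑' y, transProb r t x y = ⨆ n, ∑' y, upToFun r n x y t := by
  simp only [transProb_eq_transFun ht, transFun]
  exact ENNReal.tsum_iSup_of_monotone fun y => monotone_upToFun x y t

lemma tsum_transProb_le_one (hr : ∀ x, exitRate r x ≠ ∞) (x : S) {t : ℝ} (ht : 0 ≤ t) :
    ∑' y, transProb r t x y ≤ 1 := by
  rw [tsum_transProb_eq_iSup x ht]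
  exact iSup_le fun n => tsum_upToFun_le_one hr n x t

variable {V : S → ℝ} {C : ℝ}

/-- If a jump increases `V` by at most `1` and the jump rates are at most `C * V`, then the number of
jumps is at most that of a Yule process. -/
lemma one_le_tsum_upToFun_add (hC : 0 < C) (hV : ∀ x, 0 < V x)
    (hrV : ∀ x, exitRate r x ≤ ENNReal.ofReal (C * V x))
    (hjump : ∀ x z, r x z ≠ 0 → V z ≤ V x + 1) (n : ℕ) (x : S) {t : ℝ} (ht : 0 ≤ t) :
    1 ≤ ∑' y, upToFun r n x y t + ENNReal.ofReal (Real.exp (C * t) * (V x / (V x + n))) := by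
  -- The error term is the Chernoff bound `e^{Ct} E e^{-C T_n}` for the `n`-th jump time `T_n` of a
  -- Yule process with rates `C (V x + k)`: here `E e^{-C T_n} = ∏_{k<n} (V x + k)/(V x + k + 1) = V
  -- x/(V x + n)`.
  induction n generalizing x t with
  | zero =>
    refine le_add_left (ENNReal.one_le_ofReal.2 ?_)
    rw [Nat.cast_zero, add_zero, div_self (hV x).ne', mul_one]
    exact Real.one_le_exp (by positivity)
  | succ n ih =>
    have hx : exitRate r x ≠ ∞ := ((hrV x).trans_lt ENNReal.ofReal_lt_top).ne
    have hVx := hV x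
    set a := (exitRate r x).toReal with ha
    have ha0 : 0 ≤ a := ENNReal.toReal_nonneg
    have haV : a ≤ C * V x := ENNReal.toReal_le_of_le_ofReal (by positivity) (hrV x)
    -- As `v ↦ v/(v + n)` is nondecreasing, `K` bounds `V z/(V z + n)` for every target `z` of a
    -- jump from `x`.
    set K := (V x + 1) / (V x + 1 + n) with hK
    have hK0 : 0 ≤ K := by positivity
    have hz : ∀ s ∈ Set.Ioc 0 t, exitRate r x ≤ ∑' z, r x z * ∑' y, upToFun r n z y (t - s) +
        exitRate r x * ENNReal.ofReal (Real.exp (C * (t - s)) * K) := by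
      intro s hs
      rw [exitRate, ← ENNReal.tsum_mul_right, ← ENNReal.tsum_add]
      refine ENNReal.tsum_le_tsum fun z => ?_
      by_cases h0 : r x z = 0
      · simp [h0]
      rw [← mul_add]
      refine le_mul_of_one_le_right' ((ih z (sub_nonneg.2 hs.2)).trans ?_)
      refine add_le_add_right (ENNReal.ofReal_le_ofReal ?_) _
      refine mul_le_mul_of_nonneg_left ?_ (Real.exp_pos _).le
      have hVz := hV z
      rw [hK, div_le_div_iff₀ (by positivity) (by positivity)]
      nlinarith [mul_le_mul_of_nonneg_right (hjump x z h0) (Nat.cast_nonneg (α := ℝ) n)]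
    -- Integrating over the first jump time produces the factor `a/(a + C) ≤ V x/(V x + 1)`, whose
    -- denominator cancels the numerator of `K`.
    have hrem : exitRate r x * (∫⁻ s in Set.Ioc 0 t,
        holdFun r x s * ENNReal.ofReal (Real.exp (C * (t - s)) * K)) ≤
        ENNReal.ofReal (Real.exp (C * t) * (V x / (V x + (n + 1 : ℕ)))) := by
      have hI : ∫⁻ s in Set.Ioc 0 t, holdFun r x s * ENNReal.ofReal (Real.exp (C * (t - s)) * K) =
          ENNReal.ofReal (Real.exp (C * t) * K) *
            ∫⁻ s in Set.Ioc 0 t, ENNReal.ofReal (Real.exp (-((a + C) * s))) := by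
        rw [← lintegral_const_mul _ (by fun_prop)]
        refine setLIntegral_congr_fun measurableSet_Ioc fun s hs => ?_
        simp only [holdFun_of_nonneg r x hs.1.le, holdProb]
        rw [← ENNReal.ofReal_mul (Real.exp_pos _).le, ← ENNReal.ofReal_mul (by positivity),
          ← mul_assoc, ← Real.exp_add, mul_right_comm, ← Real.exp_add]
        congr 3
        ring
      have hexp := mul_setLIntegral_exp_add (b := a + C) (by positivity) ht
      have hle : (∫⁻ s in Set.Ioc 0 t, ENNReal.ofReal (Real.exp (-((a + C) * s)))) ≤
          ENNReal.ofReal (1 / (a + C)) := by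
        rw [ENNReal.ofReal_div_of_pos (by positivity), ENNReal.le_div_iff_mul_le
          (Or.inl (by simp; positivity)) (Or.inl ENNReal.ofReal_ne_top), ENNReal.ofReal_one,
          mul_comm, ← hexp]
        exact le_self_add
      rw [hI, ← ENNReal.ofReal_toReal hx, ← ha]
      refine (mul_le_mul_right (mul_le_mul_right hle _) _).trans ?_
      rw [← ENNReal.ofReal_mul (by positivity), ← ENNReal.ofReal_mul ha0]
      refine ENNReal.ofReal_le_ofReal ?_
      have h1 : a / (a + C) ≤ V x / (V x + 1) := by
        rw [div_le_div_iff₀ (by positivity) (by positivity)]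
        nlinarith
      calc a * (Real.exp (C * t) * K * (1 / (a + C)))
          = Real.exp (C * t) * (a / (a + C) * K) := by ring
        _ ≤ Real.exp (C * t) * (V x / (V x + 1) * K) := by gcongr
        _ = _ := by
          rw [hK]
          push_cast
          field_simp
          ring
    rw [← holdFun_add_exitRate_mul_lintegral hx ht, tsum_upToFun_succ n x t, add_assoc]
    refine add_le_add_right (le_trans ?_ (add_le_add_right hrem _)) _
    rw [← lintegral_const_mul _ (by fun_prop), ← lintegral_const_mul _ (by fun_prop),
      ← lintegral_add_right _ (by fun_prop)]
    refine setLIntegral_mono' measurableSet_Ioc fun s hs => ?_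
    rw [mul_comm, mul_left_comm, ← mul_add]
    exact mul_le_mul_right (hz s hs) _

/-- A criterion for non-explosion. -/
theorem tsum_transProb_eq_one (hC : 0 < C) (hV : ∀ x, 0 < V x)
    (hrV : ∀ x, exitRate r x ≤ ENNReal.ofReal (C * V x))
    (hjump : ∀ x z, r x z ≠ 0 → V z ≤ V x + 1) (x : S) {t : ℝ} (ht : 0 ≤ t) :
    ∑' y, transProb r t x y = 1 := by
  refine le_antisymm (tsum_transProb_le_one
    (fun x => ((hrV x).trans_lt ENNReal.ofReal_lt_top).ne) x ht) ?_
  have hlim : Filter.Tendsto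
      (fun n : ℕ => ∑' y, transProb r t x y + ENNReal.ofReal (Real.exp (C * t) * (V x / (V x + n))))
      Filter.atTop (nhds (∑' y, transProb r t x y + ENNReal.ofReal 0)) := by
    refine tendsto_const_nhds.add ((ENNReal.continuous_ofReal.tendsto _).comp ?_)
    rw [← mul_zero (Real.exp (C * t))]
    exact ((Filter.tendsto_atTop_add_const_left _ _ tendsto_natCast_atTop_atTop).const_div_atTop
      _).const_mul _
  rw [ENNReal.ofReal_zero, add_zero] at hlim
  refine ge_of_tendsto' hlim fun n => (one_le_tsum_upToFun_add hC hV hrV hjump n x ht).trans ?_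
  rw [tsum_transProb_eq_iSup x ht]
  exact add_le_add_left (le_iSup (fun n => ∑' y, upToFun r n x y t) n) _

lemma DetailedBalance.tsum_mul_transProb {m : S → ℝ≥0∞} (h : DetailedBalance r m) {t : ℝ}
    (ht : 0 ≤ t) (hone : ∀ x, ∑' y, transProb r t x y = 1) (y : S) :
    ∑' x, m x * transProb r t x y = m y := by
  simp only [h.mul_transProb ht _ y, ENNReal.tsum_mul_left, hone, mul_one]

end Mass

/-! ### Autonomous functions of a Markov chain -/

section Lumping

variable {S S' : Type*} {r : S → S → ℝ≥0∞} {r' : S' → S' → ℝ≥0∞} {φ : S → S'} {b : S → ℝ≥0∞}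

/-- Add to the clock of `y` an independent clock of rate `β`. The former is silent up to `t` if both
are, or if the latter rings first, at some time `s`, and the former stays silent for the remaining
`t - s`. -/
lemma holdFun_eq_add_lconvolution {x : S} {y : S'} {β : ℝ≥0∞} (hβ : β ≠ ∞) (hy : exitRate r' y ≠ ∞)
    (hxy : exitRate r x = exitRate r' y + β) (t : ℝ) :
    holdFun r' y t = holdFun r x t + β * (holdFun r x ⋆ₗ holdFun r' y) t := by
  rcases lt_or_ge t 0 with ht | ht
  · rw [lconvolution_eq_setLIntegral (fun u hu => holdFun_of_neg r x hu)
      (fun u hu => holdFun_of_neg r' y hu), Set.Ioc_eq_empty ht.not_gt]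
    simp [holdFun_of_neg _ _ ht]
  have hx : (exitRate r x).toReal = (exitRate r' y).toReal + β.toReal := by
    rw [hxy, ENNReal.toReal_add hy hβ]
  have hI : (holdFun r x ⋆ₗ holdFun r' y) t = holdFun r' y t *
      ∫⁻ s in Set.Ioc 0 t, ENNReal.ofReal (Real.exp (-(β.toReal * s))) := by
    rw [lconvolution_eq_setLIntegral (fun u hu => holdFun_of_neg r x hu)
      (fun u hu => holdFun_of_neg r' y hu), ← lintegral_const_mul _ (by fun_prop)]
    refine setLIntegral_congr_fun measurableSet_Ioc fun s hs => ?_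
    simp only [holdFun_of_nonneg r x hs.1.le, holdFun_of_nonneg r' y (sub_nonneg.2 hs.2),
      holdFun_of_nonneg r' y ht, holdProb]
    rw [← ENNReal.ofReal_mul (Real.exp_pos _).le, ← ENNReal.ofReal_mul (Real.exp_pos _).le,
      ← Real.exp_add, ← Real.exp_add, hx]
    congr 2
    ring
  have h1 := mul_setLIntegral_exp_add (b := β.toReal) ENNReal.toReal_nonneg ht
  rw [ENNReal.ofReal_toReal hβ] at h1
  have h2 : holdFun r x t = holdFun r' y t * ENNReal.ofReal (Real.exp (-(β.toReal * t))) := by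
    simp only [holdFun_of_nonneg _ _ ht, holdProb]
    rw [← ENNReal.ofReal_mul (Real.exp_pos _).le, ← Real.exp_add, hx]
    congr 2
    ring
  rw [hI, h2, mul_left_comm, ← mul_add, add_comm, h1, mul_one]

variable [Countable S']

/-- The backward equation is unchanged if fictitious jumps from `y` to itself at rate `β` are added;
they stand for the jumps from `x` that the projection does not see. -/
lemma transFun_eq_of_exitRate_eq {x : S} {y w : S'} {β : ℝ≥0∞} (hβ : β ≠ ∞)
    (hy : exitRate r' y ≠ ∞) (hxy : exitRate r x = exitRate r' y + β) (t : ℝ) [Decidable (y = w)] :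
    transFun r' y w t = (if y = w then holdFun r x t else 0) +
      (∑' z, r' y z * (holdFun r x ⋆ₗ transFun r' z w) t +
        β * (holdFun r x ⋆ₗ transFun r' y w) t) := by
  set G : ℝ → ℝ≥0∞ := fun t => ∑' z, r' y z * transFun r' z w t with hG
  have hGm : Measurable G := by fun_prop
  have hQ : ∀ u, transFun r' y w u = stayFun r' y w u + (holdFun r' y ⋆ₗ G) u := fun u => by
    rw [transFun_eq, hG, lconvolution_tsum_const_mul_right (by fun_prop) _ (by fun_prop)]
  have hGx : ∑' z, r' y z * (holdFun r x ⋆ₗ transFun r' z w) t = (holdFun r x ⋆ₗ G) t := by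
    rw [hG, lconvolution_tsum_const_mul_right (by fun_prop) _ (by fun_prop)]
  have h1 : (holdFun r' y ⋆ₗ G) t = (holdFun r x ⋆ₗ G) t +
      β * (holdFun r x ⋆ₗ (holdFun r' y ⋆ₗ G)) t := by
    conv_lhs => rw [lconvolution_comm, funext (holdFun_eq_add_lconvolution hβ hy hxy),
      lconvolution_add_right hGm (by fun_prop),
      lconvolution_const_mul_right _ hGm (measurable_lconvolution _ (by fun_prop) (by fun_prop))]
    rw [lconvolution_comm, lconvolution_comm (f := G),
      ← lconvolution_assoc (by fun_prop) (by fun_prop) hGm]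
  have h2 : stayFun r' y w t = (if y = w then holdFun r x t else 0) +
      β * (holdFun r x ⋆ₗ stayFun r' y w) t := by
    by_cases hyw : y = w
    · rw [if_pos hyw, show stayFun r' y w = holdFun r' y from funext fun _ => if_pos hyw]
      exact holdFun_eq_add_lconvolution hβ hy hxy t
    · rw [if_neg hyw, show stayFun r' y w = fun _ => 0 from funext fun _ => if_neg hyw,
        lconvolution_zero_right]
      simp
  rw [hGx, hQ, h1, h2, funext hQ, lconvolution_add_right (by fun_prop) (by fun_prop)]
  ring

variable [Countable S]

open Classical in
-- Both sides are decomposed at the first jump upstairs, visible or not; `b x` is the net rate of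
-- the invisible ones. Truncation at `n` jumps leaves only an inequality.
lemma tsum_upToFun_fiber_le (hb : ∀ x, b x ≠ ∞) (hr' : ∀ y, exitRate r' y ≠ ∞)
    (hφ : ∀ x (f : S' → ℝ≥0∞), ∑' z, r x z * f (φ z) = ∑' w, r' (φ x) w * f w + b x * f (φ x))
    (n : ℕ) (x : S) (w : S') (t : ℝ) :
    ∑' z, (if φ z = w then upToFun r n x z t else 0) ≤ transFun r' (φ x) w t := by
  have hexit : ∀ x, exitRate r x = exitRate r' (φ x) + b x := fun x => by
    simpa [exitRate] using hφ x fun _ => 1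
  have hstay : ∀ x t, ∑' z, (if φ z = w then stayFun r x z t else 0) =
      if φ x = w then holdFun r x t else 0 := by
    intro x t
    rw [tsum_eq_single x]
    · simp [stayFun]
    · intro z hz
      simp [stayFun, hz.symm]
  induction n generalizing x t with
  | zero =>
    simp only [upToFun_zero, hstay]
    rw [transFun_eq_of_exitRate_eq (hb x) (hr' _) (hexit x)]
    exact le_self_add
  | succ n ih =>
    have h1 : ∀ z, (if φ z = w then upToFun r (n + 1) x z t else 0) =
        (if φ z = w then stayFun r x z t else 0) +
          ∑' v, r x v * (holdFun r x ⋆ₗ fun u => if φ z = w then upToFun r n v z u else 0) t := by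
      intro z
      split_ifs
      · exact upToFun_succ r n x z t
      · simp [lconvolution_zero_right]
    simp only [h1, ENNReal.tsum_add, hstay]
    rw [ENNReal.tsum_comm, transFun_eq_of_exitRate_eq (hb x) (hr' _) (hexit x),
      ← hφ x fun v => (holdFun r x ⋆ₗ transFun r' v w) t]
    refine add_le_add_right (ENNReal.tsum_le_tsum fun v => ?_) _
    rw [ENNReal.tsum_mul_left]
    refine mul_le_mul_right ?_ _
    rw [← lconvolution_tsum_right (by fun_prop)
      (fun z => by split_ifs; exacts [measurable_upToFun r n v z, measurable_const])]
    exact lconvolution_mono_right (fun u => ih v u) t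

open Classical in
/-- If `φ` of the chain with rates `r` jumps at the autonomous rates `r'` and the chain does not
explode, then `φ` of the chain is the chain with rates `r'`. -/
theorem tsum_transProb_fiber (hb : ∀ x, b x ≠ ∞) (hr' : ∀ y, exitRate r' y ≠ ∞)
    (hφ : ∀ x (f : S' → ℝ≥0∞), ∑' z, r x z * f (φ z) = ∑' w, r' (φ x) w * f w + b x * f (φ x))
    {t : ℝ} (ht : 0 ≤ t) (x : S) (hone : ∑' z, transProb r t x z = 1)
    (w : S') : ∑' z, (if φ z = w then transProb r t x z else 0) = transProb r' t (φ x) w := by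
  have hle : ∀ w, ∑' z, (if φ z = w then transProb r t x z else 0) ≤ transProb r' t (φ x) w := by
    intro w
    have h1 : ∀ z, (if φ z = w then transProb r t x z else 0) =
        ⨆ n, if φ z = w then upToFun r n x z t else 0 := by
      intro z
      split_ifs
      · exact transProb_eq_transFun ht x z
      · simp
    simp only [h1]
    rw [ENNReal.tsum_iSup_of_monotone, transProb_eq_transFun ht]
    · exact iSup_le fun n => tsum_upToFun_fiber_le hb hr' hφ n x w t
    · intro z n n' hn
      dsimp only
      split_ifs
      · exact monotone_upToFun x z t hn
      · exact le_rfl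
  have htot : ∑' w, ∑' z, (if φ z = w then transProb r t x z else 0) = 1 := by
    rw [ENNReal.tsum_comm, ← hone]
    refine tsum_congr fun z => ?_
    rw [tsum_eq_single (φ z) fun w hw => if_neg hw.symm, if_pos rfl]
  refine le_antisymm (hle w) ?_
  -- Summed over `w`, the smaller side has mass `1` and the larger at most `1`, so no term can be
  -- strictly smaller.
  by_contra! hlt
  refine absurd (tsum_transProb_le_one hr' (φ x) ht) (not_le.2 ?_)
  rw [← htot]
  exact ENNReal.tsum_lt_tsum (by rw [htot]; exact ENNReal.one_ne_top) hle hlt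

end Lumping

/-! ### The ASEP -/

section Asep

/-- A configuration is determined by its finite sets of particles on `(-∞, 0]` and of holes on `[1,
∞)`. -/
instance AsepState.instCountable : Countable AsepState := by
  let F : AsepState → Finset ℤ × Finset ℤ := fun η => (η.2.1.toFinset, η.2.2.toFinset)
  refine Function.Injective.countable (f := F) fun η η' h => ?_
  simp only [F, Prod.mk.injEq, Set.Finite.toFinset_inj] at h
  refine Subtype.ext (funext fun i => ?_)
  have h1 := Set.ext_iff.1 h.1 i
  have h2 := Set.ext_iff.1 h.2 i
  simp only [Set.mem_ofPred_eq] at h1 h2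
  rcases le_or_gt i 0 with hi | hi
  · simp only [hi, true_and] at h1
    exact Bool.eq_iff_iff.2 h1
  · have hi' : 1 ≤ i := hi
    simp only [hi', true_and] at h2
    cases h3 : η.1 i <;> cases h4 : η'.1 i <;> simp_all

/-! ### The interface, which controls the ASEP jump rates. -/

/-- The sites `j` such that exactly one of `j` and `j + 1` is occupied. -/
def AsepState.interface (η : AsepState) : Set ℤ := {j | η.1 j ≠ η.1 (j + 1)}

lemma AsepState.finite_interface (η : AsepState) : η.interface.Finite := by
  have h1 := η.2.1.union (η.2.1.preimage (f := fun j : ℤ => j + 1) (add_left_injective 1).injOn)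
  have h2 := η.2.2.union (η.2.2.preimage (f := fun j : ℤ => j + 1) (add_left_injective 1).injOn)
  refine ((h1.union h2).union (Set.finite_singleton 0)).subset fun j hj => ?_
  simp only [AsepState.interface, Set.mem_ofPred_eq, ne_eq] at hj
  simp only [Set.mem_union, Set.mem_ofPred_eq, Set.mem_preimage, Set.mem_singleton_iff]
  rcases lt_trichotomy j 0 with h | h | h
  · have h1 : j ≤ 0 := h.le
    have h2 : j + 1 ≤ 0 := h
    cases h3 : η.1 j <;> cases h4 : η.1 (j + 1) <;> simp_all
  · exact Or.inr h
  · have h1 : 1 ≤ j := h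
    have h2 : 1 ≤ j + 1 := by omega
    cases h3 : η.1 j <;> cases h4 : η.1 (j + 1) <;> simp_all

/-- A swap affects only the edges starting at `j - 1`, `j` and `j + 1`, and the middle one was
already in the interface. -/
lemma AsepState.interface_subset_of_swap {η η' : AsepState} {j : ℤ}
    (h : η'.1 = η.1 ∘ Equiv.swap j (j + 1)) (hj : η.1 j ≠ η.1 (j + 1)) :
    η'.interface ⊆ insert (j - 1) (insert (j + 1) η.interface) := by
  intro k hk
  simp only [AsepState.interface, Set.mem_insert_iff, Set.mem_ofPred_eq] at hk ⊢
  by_contra! hcon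
  obtain ⟨h1, h2, h3⟩ := hcon
  have hkj : k ≠ j := by rintro rfl; exact hj h3
  rw [h, Function.comp_apply, Function.comp_apply, Equiv.swap_apply_of_ne_of_ne hkj h2,
    Equiv.swap_apply_of_ne_of_ne (by omega) (by omega)] at hk
  exact hk h3

lemma AsepState.ncard_interface_le_of_swap {η η' : AsepState} {j : ℤ}
    (h : η'.1 = η.1 ∘ Equiv.swap j (j + 1)) (hj : η.1 j ≠ η.1 (j + 1)) :
    η'.interface.ncard ≤ η.interface.ncard + 2 := by
  refine (Set.ncard_le_ncard (interface_subset_of_swap h hj)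
    ((η.finite_interface.insert _).insert _)).trans ?_
  have h1 := Set.ncard_insert_le (j - 1) (insert (j + 1) η.interface)
  have h2 := Set.ncard_insert_le (j + 1) η.interface
  omega

variable {q : ℝ}

lemma AsepState.ncard_interface_le {η η' : AsepState} (h : asepRate q η η' ≠ 0) :
    η'.interface.ncard ≤ η.interface.ncard + 2 := by
  rw [asepRate, ne_eq, ENNReal.tsum_eq_zero, not_forall] at h
  obtain ⟨j, hj⟩ := h
  split_ifs at hj with h1 h2 h3
  · exact ncard_interface_le_of_swap h1 (by simp [h2.1, h2.2])
  · exact ncard_interface_le_of_swap h1 (by simp [h3.1, h3.2])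
  · simp at hj
  · simp at hj

lemma exitRate_asepRate_le (hq1 : q < 1) (η : AsepState) :
    exitRate (asepRate q) η ≤ (η.interface.ncard : ℝ≥0∞) := by
  classical
  simp only [exitRate, asepRate]
  rw [ENNReal.tsum_comm]
  calc _ ≤ ∑' j, η.interface.indicator (fun _ => (1 : ℝ≥0∞)) j := by
        refine ENNReal.tsum_le_tsum fun j => ?_
        by_cases hj : j ∈ η.interface
        · rw [Set.indicator_of_mem hj]
          have hc : (if η.1 j = true ∧ η.1 (j + 1) = false then 1
              else if η.1 j = false ∧ η.1 (j + 1) = true then ENNReal.ofReal q else 0) ≤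
              (1 : ℝ≥0∞) := by
            split_ifs
            · exact le_rfl
            · exact ENNReal.ofReal_le_one.2 hq1.le
            · exact zero_le_one
          -- For an upper bound it need not be known that the swapped configuration lies in
          -- `AsepState`; otherwise the inner sum vanishes.
          by_cases hex : ∃ η' : AsepState, η'.1 = η.1 ∘ Equiv.swap j (j + 1)
          · obtain ⟨η', h'⟩ := hex
            rw [tsum_eq_single η' fun ζ hζ => if_neg fun h => hζ (Subtype.ext (h.trans h'.symm)),
              if_pos h']
            exact hc
          · refine (ENNReal.tsum_eq_zero.2 fun η' => ?_).trans_le zero_le_one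
            exact if_neg fun h => hex ⟨η', h⟩
        · rw [Set.indicator_of_notMem hj, nonpos_iff_eq_zero, ENNReal.tsum_eq_zero]
          intro η'
          have hj' : η.1 j = η.1 (j + 1) := by simpa [AsepState.interface] using hj
          cases h1 : η.1 j <;> simp [← hj', h1]
    _ = η.interface.encard := by
        rw [← tsum_subtype, ENNReal.tsum_set_const, mul_one]
    _ = _ := by rw [← η.finite_interface.cast_ncard_eq]; rfl

lemma exitRate_asepRate_ne_top (hq1 : q < 1) (η : AsepState) : exitRate (asepRate q) η ≠ ∞ :=
  ((exitRate_asepRate_le hq1 η).trans_lt (ENNReal.natCast_lt_top _)).ne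

/-! #### Blocking measures -/

lemma blockingMarginal_pos (hq0 : 0 < q) (c : ℝ) (i : ℤ) (b : Bool) :
    0 < blockingMarginal q c i b := by
  unfold blockingMarginal; positivity

lemma log_blockingMarginal_true (hq0 : 0 < q) (c : ℝ) (i : ℤ) :
    Real.log (blockingMarginal q c i true) = -Real.log (1 + q ^ ((i : ℝ) - c)) := by
  rw [← Real.log_inv]
  congr 1
  simp only [blockingMarginal, Bool.toNat_true, Nat.cast_one, mul_one]
  rw [Real.rpow_neg hq0.le]
  have : 0 < q ^ ((i : ℝ) - c) := by positivity
  field_simp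
  ring

lemma log_blockingMarginal_false (c : ℝ) (i : ℤ) :
    Real.log (blockingMarginal q c i false) = -Real.log (1 + q ^ (-((i : ℝ) - c))) := by
  rw [← Real.log_inv]
  simp [blockingMarginal]

lemma summable_log_one_add_mul_pow (hq0 : 0 < q) (hq1 : q < 1) {K : ℝ} (hK : 0 < K) :
    Summable fun n : ℕ => Real.log (1 + K * q ^ n) := by
  refine Summable.of_nonneg_of_le (fun n => Real.log_nonneg ?_) (fun n => ?_)
    ((summable_geometric_of_lt_one hq0.le hq1).mul_left K)
  · have : 0 < K * q ^ n := by positivity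
    linarith
  · have := Real.log_le_sub_one_of_pos (x := 1 + K * q ^ n) (by positivity)
    linarith

/-- Far to the right there are only particles and far to the left only holes, and there the
logarithms decay geometrically. So the infinite product is the exponential of a convergent sum. -/
lemma summable_log_blockingMarginal (hq0 : 0 < q) (hq1 : q < 1) (c : ℝ) (η : AsepState) :
    Summable fun i => Real.log (blockingMarginal q c i (η.1 i)) := by
  have hpos : ∀ᶠ n : ℕ in Filter.cofinite, η.1 n = true := by
    have h1 := η.2.2.preimage (f := fun n : ℕ => (n : ℤ)) Nat.cast_injective.injOn
    -- The site `0` is removed because the condition on holes concerns only sites `≥ 1`.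
    filter_upwards [h1.compl_mem_cofinite, (Set.finite_singleton 0).compl_mem_cofinite] with n hn h0
    simp only [Set.preimage_ofPred_eq, Set.mem_compl_iff, Set.mem_ofPred_eq, not_and,
      Bool.not_eq_false, Set.mem_singleton_iff] at hn h0
    exact hn (by omega)
  have hneg : ∀ᶠ n : ℕ in Filter.cofinite, η.1 (-n) = false := by
    have h1 := η.2.1.preimage (f := fun n : ℕ => -(n : ℤ))
      (neg_injective.comp Nat.cast_injective).injOn
    filter_upwards [h1.compl_mem_cofinite] with n hn
    simp only [Set.preimage_ofPred_eq, Set.mem_compl_iff, Set.mem_ofPred_eq, not_and,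
      Bool.not_eq_true] at hn
    exact hn (by omega)
  refine Summable.of_nat_of_neg ?_ ?_
  · refine (summable_congr_cofinite ?_).1
      (summable_log_one_add_mul_pow hq0 hq1 (K := q ^ (-c)) (by positivity)).neg
    filter_upwards [hpos] with n hn
    rw [hn, log_blockingMarginal_true hq0, sub_eq_neg_add, Real.rpow_add hq0]
    simp
  · refine (summable_congr_cofinite ?_).1
      (summable_log_one_add_mul_pow hq0 hq1 (K := q ^ c) (by positivity)).neg
    filter_upwards [hneg] with n hn
    rw [hn, log_blockingMarginal_false, neg_sub, sub_eq_add_neg, Real.rpow_add hq0]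
    simp

lemma blockingMeasure_ne_zero (hq0 : 0 < q) (hq1 : q < 1) (c : ℝ) (η : AsepState) :
    blockingMeasure q c η ≠ 0 := by
  rw [blockingMeasure, ← Real.rexp_tsum_eq_tprod (fun i => blockingMarginal_pos hq0 c i _)
    (summable_log_blockingMarginal hq0 hq1 c η)]
  simpa using Real.exp_pos _

/-- Only the factors at `j` and `j + 1` change. The odds of a particle at `i` are `q^{-(i-c)}`, so
moving it from `j` to `j + 1` divides the weight by `q`. -/
lemma blockingMeasure_swap (hq0 : 0 < q) (hq1 : q < 1) (c : ℝ) {η η' : AsepState} {j : ℤ}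
    (h : η'.1 = η.1 ∘ Equiv.swap j (j + 1)) (h0 : η.1 j = true) (h1 : η.1 (j + 1) = false) :
    blockingMeasure q c η = blockingMeasure q c η' * ENNReal.ofReal q := by
  have hd : ∀ i, Real.log (blockingMarginal q c i true) - Real.log (blockingMarginal q c i false) =
      -((i : ℝ) - c) * Real.log q := by
    intro i
    rw [← Real.log_div (blockingMarginal_pos hq0 c i _).ne' (blockingMarginal_pos hq0 c i _).ne',
      ← Real.log_rpow hq0]
    congr 1
    simp only [blockingMarginal, Bool.toNat_true, Bool.toNat_false, Nat.cast_one, Nat.cast_zero,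
      mul_one, mul_zero, Real.rpow_zero]
    have : 0 < q ^ (-((i : ℝ) - c)) := by positivity
    field_simp
  have hs := summable_log_blockingMarginal hq0 hq1 c
  have hsum : ∑' i, Real.log (blockingMarginal q c i (η.1 i)) =
      ∑' i, Real.log (blockingMarginal q c i (η'.1 i)) + Real.log q := by
    rw [← sub_eq_iff_eq_add', ← (hs η).tsum_sub (hs η'), tsum_eq_sum (s := {j, j + 1}),
      Finset.sum_pair (by simp), show η'.1 j = η.1 (j + 1) by simp [h],
      show η'.1 (j + 1) = η.1 j by simp [h], h0, h1, hd, ← neg_sub (Real.log _), hd]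
    · push_cast
      ring
    · intro i hi
      simp only [Finset.mem_insert, Finset.mem_singleton, not_or] at hi
      rw [h, Function.comp_apply, Equiv.swap_apply_of_ne_of_ne hi.1 hi.2, sub_self]
  rw [blockingMeasure, blockingMeasure,
    ← Real.rexp_tsum_eq_tprod (fun i => blockingMarginal_pos hq0 c i _) (hs η),
    ← Real.rexp_tsum_eq_tprod (fun i => blockingMarginal_pos hq0 c i _) (hs η'),
    hsum, Real.exp_add, Real.exp_log hq0, ENNReal.ofReal_mul (Real.exp_pos _).le]

lemma detailedBalance_blockingMeasure (hq0 : 0 < q) (hq1 : q < 1) (c : ℝ) :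
    DetailedBalance (asepRate q) (blockingMeasure q c) := by
  intro η η'
  simp only [asepRate, ← ENNReal.tsum_mul_left]
  refine tsum_congr fun j => ?_
  by_cases h : η'.1 = η.1 ∘ Equiv.swap j (j + 1)
  · have h' : η.1 = η'.1 ∘ Equiv.swap j (j + 1) := by
      rw [h, Function.comp_assoc, ← Equiv.coe_trans, Equiv.swap_swap]; rfl
    have e1 : η'.1 j = η.1 (j + 1) := by simp [h]
    have e2 : η'.1 (j + 1) = η.1 j := by simp [h]
    rw [if_pos h, if_pos h', e1, e2]
    cases h0 : η.1 j <;> cases h1 : η.1 (j + 1)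
    · simp
    · simpa using (blockingMeasure_swap hq0 hq1 c h' (e1.trans h1) (e2.trans h0)).symm
    · simpa using blockingMeasure_swap hq0 hq1 c h h0 h1
    · simp
  · have h' : ¬ η.1 = η'.1 ∘ Equiv.swap j (j + 1) := fun h' => h (by
      rw [h', Function.comp_assoc, ← Equiv.coe_trans, Equiv.swap_swap]; rfl)
    rw [if_neg h, if_neg h', mul_zero, mul_zero]

end Asep

/-! ### The label process -/

section Label

variable {q : ℝ} {d : ℕ}

lemma exitRate_labelRate_le (hq1 : q < 1) (η : AsepState) (x : LabelState d) :
    exitRate (labelRate q η) x ≤ 2 * d := by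
  classical
  simp only [exitRate, labelRate]
  rw [Summable.tsum_finsetSum fun _ _ => ENNReal.summable]
  calc _ ≤ ∑ _k : Fin d, (2 : ℝ≥0∞) := by
        refine Finset.sum_le_sum fun k _ => ?_
        rw [ENNReal.tsum_add, ← one_add_one_eq_two]
        have aux : ∀ (p : LabelState d → Prop) [DecidablePred p] (c : ℝ≥0∞), c ≤ 1 →
            (∀ y z, p y → p z → y = z) → ∑' y, (if p y then c else 0) ≤ 1 := by
          intro p _ c hc hp
          by_cases hex : ∃ y, p y
          · obtain ⟨y, hy⟩ := hex
            rw [tsum_eq_single y fun z hz => if_neg fun h => hz (hp _ _ h hy), if_pos hy]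
            exact hc
          · refine (ENNReal.tsum_eq_zero.2 fun y => ?_).trans_le zero_le_one
            exact if_neg fun h => hex ⟨y, h⟩
        refine add_le_add (aux _ _ (ENNReal.ofReal_le_one.2 hq1.le) ?_) (aux _ _ le_rfl ?_)
        · intro y z hy hz
          exact Subtype.ext (hy.1.trans hz.1.symm)
        · intro y z hy hz
          exact Subtype.ext (add_right_cancel (hy.1.symm.trans hz.1))
    _ = _ := by simp [mul_comm]

lemma exitRate_labelRate_ne_top (hq1 : q < 1) (η : AsepState) (x : LabelState d) :
    exitRate (labelRate q η) x ≠ ∞ :=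
  ((exitRate_labelRate_le hq1 η x).trans_lt (by finiteness)).ne

lemma labelDist_add_single (hq0 : 0 < q) {x x' : LabelState d} {k : Fin d}
    (h : x'.1 = x.1 + Pi.single k 1) :
    labelDist q d x' = labelDist q d x * ENNReal.ofReal q := by
  rw [labelDist, labelDist, ← ENNReal.ofReal_mul' hq0.le, h]
  have hs : ∑ i, (((x.1 + Pi.single k 1 : Fin d → ℕ) i : ℕ) : ℝ) = ∑ i, (x.1 i : ℝ) + 1 := by
    simp [Finset.sum_add_distrib, Pi.single_apply]
  rw [hs, add_sub_right_comm, Real.rpow_add hq0, Real.rpow_one, mul_assoc]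

/-- Opposite crossings of an edge require the same adjacency in `η`, so closing edges removes
balanced pairs of rates. -/
lemma detailedBalance_labelRate (hq0 : 0 < q) (η : AsepState) :
    DetailedBalance (labelRate q η) (labelDist q d) := by
  intro x x'
  simp only [labelRate, Finset.mul_sum]
  refine Finset.sum_congr rfl fun k _ => ?_
  rw [mul_add, mul_add, add_comm]
  congr 1
  · split_ifs with h
    · rw [labelDist_add_single hq0 h.1, mul_one]
    · rw [mul_zero, mul_zero]
  · split_ifs with h
    · rw [labelDist_add_single hq0 h.1, mul_one]
    · rw [mul_zero, mul_zero]

/-- A configuration of `d + 1` labels, encoded by its least label and the shifted other ones. -/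
def LabelState.consEquiv (d : ℕ) : ℕ × LabelState d ≃ LabelState (d + 1) where
  toFun p := ⟨Fin.cons p.1 fun i => p.1 + 1 + p.2.1 i, by
    intro i j
    refine Fin.cases ?_ (fun j => ?_) j
    · intro h
      exact absurd h (Fin.not_lt_zero i)
    refine Fin.cases ?_ (fun i => ?_) i
    · intro _
      simp only [Fin.cons_zero, Fin.cons_succ]
      omega
    · intro h
      simpa using p.2.2 (Fin.succ_lt_succ_iff.1 h)⟩
  invFun x := (x.1 0, ⟨fun i => x.1 i.succ - x.1 0 - 1, by
    intro i j hij
    have h1 := x.2 (Fin.succ_lt_succ_iff.2 hij)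
    have h2 := x.2 (Fin.succ_pos i)
    dsimp only
    omega⟩)
  left_inv p := by
    ext i
    · simp
    · simp
      omega
  right_inv x := by
    refine Subtype.ext (funext fun i => ?_)
    refine Fin.cases ?_ (fun i => ?_) i
    · simp
    · have h2 := x.2 (Fin.succ_pos i)
      simp
      omega

/-- Peeling off the least label `n` and shifting the others by `n + 1` contributes `n (d + 1) + d`
to the exponent, hence a geometric series of ratio `q ^ (d + 1)`. -/
lemma tsum_pow_labelState (hq0 : 0 < q) (hq1 : q < 1) (d : ℕ) :
    ∑' x : LabelState d, ENNReal.ofReal (q ^ (∑ i, x.1 i)) =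
      ENNReal.ofReal (q ^ (∑ i ∈ Finset.range d, i) / ∏ i ∈ Finset.Icc 1 d, (1 - q ^ i)) := by
  induction d with
  | zero =>
    have : Unique (LabelState 0) := ⟨⟨⟨Fin.elim0, fun i => i.elim0⟩⟩, fun x =>
      Subtype.ext (Subsingleton.elim _ _)⟩
    rw [tsum_eq_single default fun x hx => absurd (Subsingleton.elim _ _) hx]
    simp
  | succ d ih =>
    have hsum : ∀ p : ℕ × LabelState d, ∑ i, (LabelState.consEquiv d p).1 i =
        p.1 * (d + 1) + d + ∑ i, p.2.1 i := by
      intro p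
      simp only [LabelState.consEquiv, Equiv.coe_fn_mk, Fin.sum_univ_succ, Fin.cons_zero,
        Fin.cons_succ, Finset.sum_add_distrib, Finset.sum_const, Finset.card_univ,
        Fintype.card_fin, smul_eq_mul]
      ring
    have hqd : q ^ (d + 1) < 1 := pow_lt_one₀ hq0.le hq1 (by omega)
    rw [← (LabelState.consEquiv d).tsum_eq]
    simp only [hsum]
    have hmul : ∀ p : ℕ × LabelState d, ENNReal.ofReal (q ^ (p.1 * (d + 1) + d + ∑ i, p.2.1 i)) =
        ENNReal.ofReal ((q ^ (d + 1)) ^ p.1) * (ENNReal.ofReal (q ^ d) *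
          ENNReal.ofReal (q ^ (∑ i, p.2.1 i))) := by
      intro p
      rw [← ENNReal.ofReal_mul (by positivity), ← ENNReal.ofReal_mul (by positivity)]
      congr 1
      ring
    simp only [hmul]
    rw [ENNReal.tsum_prod']
    simp only [ENNReal.tsum_mul_left, ENNReal.tsum_mul_right, ih]
    rw [← ENNReal.ofReal_tsum_of_nonneg (fun n => by positivity)
      (summable_geometric_of_lt_one (by positivity) hqd), tsum_geometric_of_lt_one (by positivity) hqd,
      ← ENNReal.ofReal_mul (by positivity), ← ENNReal.ofReal_mul (by
        rw [inv_nonneg]; linarith), Finset.sum_range_succ, Finset.prod_Icc_succ_top (by omega)]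
    congr 1
    rw [mul_div_assoc', ← pow_add, add_comm d (∑ i ∈ Finset.range d, i), inv_mul_eq_div, div_div]

lemma tsum_labelDist (hq0 : 0 < q) (hq1 : q < 1) (d : ℕ) : ∑' x, labelDist q d x = 1 := by
  have hpos : 0 < ∏ i ∈ Finset.Icc 1 d, (1 - q ^ i) := by
    refine Finset.prod_pos fun i hi => sub_pos.2 (pow_lt_one₀ hq0.le hq1 ?_)
    have := (Finset.mem_Icc.1 hi).1
    omega
  have hG : ∀ d : ℕ, ((∑ i ∈ Finset.range d, i : ℕ) : ℝ) = (d : ℝ) * ((d : ℝ) - 1) / 2 := by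
    intro d
    induction d with
    | zero => simp
    | succ d ih =>
      rw [Finset.sum_range_succ, Nat.cast_add, ih]
      push_cast
      ring
  have h : ∀ x : LabelState d, labelDist q d x = ENNReal.ofReal
      ((∏ i ∈ Finset.Icc 1 d, (1 - q ^ i)) / q ^ (∑ i ∈ Finset.range d, i)) *
        ENNReal.ofReal (q ^ (∑ i, x.1 i)) := by
    intro x
    rw [labelDist, ← hG, Real.rpow_sub hq0, ← Nat.cast_sum, Real.rpow_natCast, Real.rpow_natCast,
      ← ENNReal.ofReal_mul (by positivity)]
    congr 1
    ring
  simp only [h, ENNReal.tsum_mul_left]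
  rw [tsum_pow_labelState hq0 hq1, ← ENNReal.ofReal_mul (by positivity), ← ENNReal.ofReal_one]
  congr 1
  field_simp

end Label

/-! ### The joint chain -/

section Joint

variable {q : ℝ} {d : ℕ}

/-- This is the lumping hypothesis for `Prod.fst`: label moves are the invisible jumps. -/
lemma tsum_jointRate_mul (z : AsepState × LabelState d) (f : AsepState → ℝ≥0∞) :
    ∑' z', jointRate q d z z' * f z'.1 =
      ∑' η', asepRate q z.1 η' * f η' + exitRate (labelRate q z.1) z.2 * f z.1 := by
  obtain ⟨η, x⟩ := z
  simp only [jointRate, add_mul, ite_mul, zero_mul]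
  rw [ENNReal.tsum_add]
  congr 1
  · rw [ENNReal.tsum_prod']
    refine tsum_congr fun η' => ?_
    rw [tsum_eq_single x fun x' hx => if_neg hx.symm, if_pos rfl]
  · rw [ENNReal.tsum_prod', tsum_eq_single η]
    · simp [exitRate, ENNReal.tsum_mul_right]
    · intro η' hη
      simp [hη.symm]

lemma exitRate_jointRate (z : AsepState × LabelState d) : exitRate (jointRate q d) z =
    exitRate (asepRate q) z.1 + exitRate (labelRate q z.1) z.2 := by
  simpa [exitRate] using tsum_jointRate_mul (q := q) z fun _ => 1

lemma tsum_transProb_jointRate (hq1 : q < 1) (hd : 0 < d) {t : ℝ} (ht : 0 ≤ t)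
    (z : AsepState × LabelState d) : ∑' z', transProb (jointRate q d) t z z' = 1 := by
  have hd' : (0 : ℝ) < d := Nat.cast_pos.2 hd
  -- The total rate is at most the interface size plus `2 * d`, that is `2 * V`. An ASEP jump
  -- enlarges the interface by at most `2`, hence the division by `2`.
  refine tsum_transProb_eq_one (V := fun z => (z.1.interface.ncard : ℝ) / 2 + d) two_pos
    (fun z => by positivity) (fun z => ?_) (fun z z' h => ?_) z ht
  · rw [exitRate_jointRate]
    refine (add_le_add (exitRate_asepRate_le hq1 _) (exitRate_labelRate_le hq1 _ _)).trans_eq ?_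
    rw [mul_add, mul_div_cancel₀ _ two_ne_zero, ENNReal.ofReal_add (by positivity) (by positivity),
      ENNReal.ofReal_mul zero_le_two]
    simp
  · have hle : z'.1.interface.ncard ≤ z.1.interface.ncard + 2 := by
      by_cases h1 : z.1 = z'.1
      · rw [h1]; omega
      · rw [jointRate, if_neg h1, add_zero] at h
        exact AsepState.ncard_interface_le (q := q) fun h0 => h (by simp [h0])
    have hle' : (z'.1.interface.ncard : ℝ) ≤ z.1.interface.ncard + 2 := by exact_mod_cast hle
    linarith

lemma DetailedBalance.jointRate (hq0 : 0 < q) {m : AsepState → ℝ≥0∞}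
    (hm : DetailedBalance (asepRate q) m) :
    DetailedBalance (jointRate q d) fun z => m z.1 * labelDist q d z.2 := by
  rintro ⟨η, x⟩ ⟨η', x'⟩
  simp only [_root_.jointRate, mul_add]
  congr 1
  · by_cases h : x = x'
    · rw [if_pos h, if_pos h.symm, h, mul_right_comm, hm η η', mul_right_comm]
    · rw [if_neg h, if_neg (Ne.symm h), mul_zero, mul_zero]
  · by_cases h : η = η'
    · rw [if_pos h, if_pos h.symm, h, mul_assoc, detailedBalance_labelRate hq0 η' x x', mul_assoc]
    · rw [if_neg h, if_neg (Ne.symm h), mul_zero, mul_zero]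

lemma isReversibleStationary_labelDist (hq0 : 0 < q) (hq1 : q < 1) (hd : 0 < d) (η : AsepState) :
    IsReversibleStationary (labelRate q (d := d) η) (labelDist q d) where
  total := tsum_labelDist hq0 hq1 d
  stationary t ht y := (detailedBalance_labelRate hq0 η).tsum_mul_transProb ht (fun x =>
    tsum_transProb_eq_one (V := fun _ => (d : ℝ)) two_pos (fun _ => Nat.cast_pos.2 hd) (fun x => by
      simpa using exitRate_labelRate_le hq1 η x) (fun x z _ => by simp) x ht) y
  reversible t ht x y := (detailedBalance_labelRate hq0 η).mul_transProb ht x y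

/-- The background is an ASEP on its own. -/
lemma tsum_transProb_jointRate_snd (hq1 : q < 1) (hd : 0 < d) {t : ℝ} (ht : 0 ≤ t) (η η' : AsepState)
    (x : LabelState d) :
    ∑' x', transProb (jointRate q d) t (η, x) (η', x') = transProb (asepRate q) t η η' := by
  classical
  rw [← tsum_transProb_fiber (r := jointRate q d) (φ := Prod.fst) (x := (η, x))
    (fun z : AsepState × LabelState d => exitRate_labelRate_ne_top hq1 z.1 z.2)
    (exitRate_asepRate_ne_top hq1) tsum_jointRate_mul ht (tsum_transProb_jointRate hq1 hd ht _) η',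
    ENNReal.tsum_prod', tsum_eq_single η']
  · simp
  · intro ζ hζ
    simp [hζ]

/-- If the labels start from `labelDist`, they have the same law at time `t` given the background at
times `0` and `t`. -/
lemma tsum_labelDist_mul_transProb (hq0 : 0 < q) (hq1 : q < 1) (hd : 0 < d) {t : ℝ} (ht : 0 ≤ t)
    (η η' : AsepState) (x' : LabelState d) :
    ∑' x, labelDist q d x * transProb (jointRate q d) t (η, x) (η', x') =
      transProb (asepRate q) t η η' * labelDist q d x' := by
  -- Any positive finite reversible weight would do here, normalized or not; it is cancelled after
  -- time reversal.
  have hm := detailedBalance_blockingMeasure hq0 hq1 0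
  refine (ENNReal.mul_right_inj (blockingMeasure_ne_zero hq0 hq1 0 η) ENNReal.ofReal_ne_top).1 ?_
  rw [← ENNReal.tsum_mul_left, ← mul_assoc, hm.mul_transProb ht,
    ← tsum_transProb_jointRate_snd hq1 hd ht η' η x', mul_right_comm, ← ENNReal.tsum_mul_left]
  refine tsum_congr fun x => ?_
  rw [← mul_assoc]
  exact (hm.jointRate hq0).mul_transProb ht (η, x) (η', x')

end Joint

/-! ### Processes with countable state space -/

section CountableStateSpace

variable {S : Type*} {Ω' : Type*} [MeasurableSpace Ω'] {P : Measure Ω'}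
  {r : S → S → ℝ≥0∞} {m : S → ℝ≥0∞} {Z : ℝ≥0 → Ω' → S}

/-- The weight is pushed along the path, each step reversing one factor. The kernels depend on `i`
because the time increments differ. -/
lemma mul_prod_eq_of_symm {n : ℕ} {p : Fin n → S → S → ℝ≥0∞}
    (h : ∀ i x y, m x * p i x y = m y * p i y x) (z : Fin (n + 1) → S) :
    m (z 0) * ∏ i, p i (z i.castSucc) (z i.succ) =
      m (z (Fin.last n)) * ∏ i, p i (z i.succ) (z i.castSucc) := by
  induction n with
  | zero => simp
  | succ n ih =>
    have ih' := ih (p := fun i => p i.castSucc) (fun i => h _) (fun i => z i.castSucc)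
    rw [Fin.prod_univ_castSucc, Fin.prod_univ_castSucc, ← mul_assoc]
    rw [Fin.castSucc_zero] at ih'
    simp only [Fin.succ_castSucc]
    rw [ih', mul_right_comm, h, mul_right_comm, Fin.succ_last]
    ring

variable [MeasurableSpace S] [MeasurableSingletonClass S]

lemma measurableSet_forall_eq {ι : Type*} [Finite ι] {X : ι → Ω' → S} (hX : ∀ i, Measurable (X i))
    (z : ι → S) : MeasurableSet {ω | ∀ i, X i ω = z i} := by
  rw [Set.ofPred_forall]
  exact MeasurableSet.iInter fun i => hX i (measurableSet_singleton _)

variable [Countable S]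

lemma measure_eq_tsum_fiber {A : Set Ω'} (hA : MeasurableSet A) {f : Ω' → S} (hf : Measurable f) :
    P A = ∑' b, P {ω | f ω = b ∧ ω ∈ A} := by
  rw [← measure_iUnion]
  · congr 1
    ext ω
    simp
  · intro b b' hb
    rw [Function.onFun, Set.disjoint_left]
    rintro ω ⟨h1, _⟩ ⟨h2, _⟩
    exact hb (h1.symm.trans h2)
  · exact fun b => (hf (measurableSet_singleton b)).inter hA

/-- The law of a process is determined by its finite restrictions, and in a countable space these
are determined by singletons; finitely many times can be listed in order. -/
lemma identDistrib_of_forall_monotone [IsProbabilityMeasure P] {T : Type*} [LinearOrder T]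
    {X Y : T → Ω' → S} (hX : ∀ t, Measurable (X t)) (hY : ∀ t, Measurable (Y t))
    (h : ∀ (n : ℕ) (t : Fin (n + 1) → T) (z : Fin (n + 1) → S), Monotone t →
      P {ω | ∀ i, X (t i) ω = z i} = P {ω | ∀ i, Y (t i) ω = z i}) :
    IdentDistrib (fun ω t => X t ω) (fun ω t => Y t ω) P P := by
  have hXm : Measurable fun ω t => X t ω := measurable_pi_lambda _ hX
  have hYm : Measurable fun ω t => Y t ω := measurable_pi_lambda _ hY
  refine ⟨hXm.aemeasurable, hYm.aemeasurable, (map_eq_iff_forall_finset_map_restrict_eq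
    hXm.aemeasurable hYm.aemeasurable).2 fun I => Measure.ext_of_singleton fun z => ?_⟩
  have hXI : Measurable fun ω => I.restrict (X · ω) := (Finset.measurable_restrict I).comp hXm
  have hYI : Measurable fun ω => I.restrict (Y · ω) := (Finset.measurable_restrict I).comp hYm
  rw [Measure.map_apply hXI (measurableSet_singleton z),
    Measure.map_apply hYI (measurableSet_singleton z)]
  rcases I.eq_empty_or_nonempty with rfl | hI
  · congr 1
    ext ω
    simp only [Set.mem_preimage, Set.mem_singleton_iff]
    exact iff_of_true (Subsingleton.elim _ _) (Subsingleton.elim _ _)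
  obtain ⟨n, hn⟩ := Nat.exists_eq_succ_of_ne_zero hI.card_ne_zero
  let e := I.orderIsoOfFin hn
  have hev : ∀ W : T → Ω' → S, (fun ω => I.restrict (W · ω)) ⁻¹' {z} =
      {ω | ∀ i, W (e i) ω = z (e i)} := by
    intro W
    ext ω
    simp only [Set.mem_preimage, Set.mem_singleton_iff, Set.mem_ofPred_eq, funext_iff]
    exact e.surjective.forall
  rw [hev, hev]
  exact h n _ _ fun i j hij => e.monotone hij

/-- The finite-dimensional distributions of a Markov chain with stationary initial weights. -/
lemma IsMarkovChain.fdd_of_stationary (hZ : IsMarkovChain P r m Z)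
    (hm : ∀ t : ℝ, 0 ≤ t → ∀ y, ∑' x, m x * transProb r t x y = m y)
    {n : ℕ} {t : Fin (n + 1) → ℝ≥0} (z : Fin (n + 1) → S) (ht : Monotone t) :
    P {ω | ∀ i, Z (t i) ω = z i} =
      m (z 0) * ∏ i : Fin n,
        transProb r ((t i.succ : ℝ) - (t i.castSucc : ℝ)) (z i.castSucc) (z i.succ) := by
  -- As `fdd` starts at time `0`, that time is prepended; summing over the state there absorbs the
  -- first transition by stationarity.
  rw [measure_eq_tsum_fiber (measurableSet_forall_eq (fun i => hZ.measurable (t i)) z)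
    (hZ.measurable 0), ← hm (t 0) (t 0).2, ← ENNReal.tsum_mul_right]
  refine tsum_congr fun w => ?_
  have h := hZ.fdd (n + 1) (Fin.cons 0 t) (Fin.cons w z) rfl (by
    intro i j
    refine Fin.cases (fun _ => by simp) (fun i => ?_) i
    refine Fin.cases (fun h => absurd h (by simp)) (fun j h => ?_) j
    simpa using ht (Fin.succ_le_succ_iff.1 h))
  rw [Fin.prod_univ_succ] at h
  simp only [Fin.forall_fin_succ (n := n + 1), Fin.cons_zero, Fin.cons_succ, Fin.castSucc_zero,
    NNReal.coe_zero, sub_zero, ← Fin.succ_castSucc] at h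
  rw [mul_assoc]
  exact h

variable [IsProbabilityMeasure P]

lemma IsMarkovChain.isStationaryProcess (hZ : IsMarkovChain P r m Z)
    (hm : ∀ t : ℝ, 0 ≤ t → ∀ y, ∑' x, m x * transProb r t x y = m y) :
    IsStationaryProcess P Z := by
  intro s
  refine identDistrib_of_forall_monotone (X := fun t => Z (s + t)) (fun t => hZ.measurable _)
    hZ.measurable fun n t z ht => ?_
  rw [hZ.fdd_of_stationary hm z ht,
    hZ.fdd_of_stationary (t := fun i => s + t i) hm z fun i j hij => add_le_add_right (ht hij) s]
  simp only [NNReal.coe_add, add_sub_add_left_eq_sub]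

lemma IsMarkovChain.isReversibleProcess (hZ : IsMarkovChain P r m Z)
    (hm : ∀ t : ℝ, 0 ≤ t → ∀ y, ∑' x, m x * transProb r t x y = m y)
    (hb : DetailedBalance r m) : IsReversibleProcess P Z := by
  intro T
  refine identDistrib_of_forall_monotone (X := fun t : Set.Iic T => Z (T - t))
    (Y := fun t : Set.Iic T => Z t) (fun t => hZ.measurable _)
    (fun t => hZ.measurable _) fun n t z ht => ?_
  -- The times `T - t i` decrease, so the indices are reversed before `fdd_of_stationary` applies.
  have hrev : {ω | ∀ i, Z (T - t i) ω = z i} = {ω | ∀ i : Fin (n + 1), Z (T - t i.rev) ω = z i.rev} := by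
    ext ω
    exact Fin.rev_surjective.forall
  have hle : ∀ i, (t i : ℝ≥0) ≤ T := fun i => (t i).2
  have hmono : Monotone fun i => T - (t (Fin.rev i) : ℝ≥0) := fun i j hij =>
    tsub_le_tsub_left (Subtype.coe_le_coe.2 (ht (Fin.rev_le_rev.2 hij))) T
  rw [hrev, hZ.fdd_of_stationary (t := fun i => (t i : ℝ≥0)) hm z ht,
    hZ.fdd_of_stationary (t := fun i => T - (t i.rev : ℝ≥0)) hm (fun i => z i.rev)
      hmono,
    mul_prod_eq_of_symm (p := fun i => transProb r _) (fun i => hb.mul_transProb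
      (sub_nonneg.2 (NNReal.coe_le_coe.2 (ht (Fin.castSucc_lt_succ (i := i)).le)))) z]
  rw [Fin.rev_zero, ← Fin.rev_bijective.prod_comp]
  simp only [Fin.rev_castSucc, Fin.rev_succ, NNReal.coe_sub (hle _), Fin.rev_rev,
    sub_sub_sub_cancel_left]

end CountableStateSpace

/-! ### Independence of the labels and the background -/

section Independence

variable {A B : Type*}

open Classical in
-- Labels before index `k` are summed from the left, `hw` carrying `w` forward; labels after `k` are
-- summed from the right by `hp`.
lemma tsum_mul_prod_eq {w : B → ℝ≥0∞} {n : ℕ}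
    {p : Fin n → A × B → A × B → ℝ≥0∞} {Q : Fin n → A → A → ℝ≥0∞}
    (hp : ∀ i a a' b, ∑' b', p i (a, b) (a', b') = Q i a a')
    (hw : ∀ i a a' b', ∑' b, w b * p i (a, b) (a', b') = Q i a a' * w b')
    (a : Fin (n + 1) → A) (k : Fin (n + 1)) (b₀ : B) :
    ∑' b : Fin (n + 1) → B, (if b k = b₀ then
      w (b 0) * ∏ i, p i (a i.castSucc, b i.castSucc) (a i.succ, b i.succ) else 0) =
      w b₀ * ∏ i, Q i (a i.castSucc) (a i.succ) := by
  induction n generalizing b₀ with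
  | zero =>
    obtain rfl : k = 0 := Fin.fin_one_eq_zero k
    rw [tsum_eq_single fun _ => b₀]
    · simp
    · intro b hb
      refine if_neg fun h => hb (funext fun i => ?_)
      rw [Fin.fin_one_eq_zero i, h]
  | succ n ih =>
    have ih' := ih (p := fun i => p i.castSucc) (Q := fun i => Q i.castSucc)
      (fun i => hp _) (fun i => hw _) (fun i => a i.castSucc)
    rw [← (Fin.snocEquiv fun _ => B).tsum_eq, ENNReal.tsum_prod', Fin.prod_univ_castSucc]
    simp only [Fin.snocEquiv_apply, Fin.prod_univ_castSucc (n := n), Fin.succ_castSucc,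
      Fin.succ_last, Fin.snoc_last, Fin.snoc_castSucc]
    have h0 : ∀ (b : Fin (n + 1) → B) (v : B),
        (Fin.snoc (α := fun _ => B) b v : Fin (n + 2) → B) 0 = b 0 := fun b v =>
      Fin.snoc_castSucc (α := fun _ => B) v b 0
    set L : (Fin (n + 1) → B) → ℝ≥0∞ := fun b => w (b 0) * ∏ i : Fin n,
      p i.castSucc (a i.castSucc.castSucc, b i.castSucc) (a i.succ.castSucc, b i.succ) with hL
    simp only [h0, ← mul_assoc]
    refine Fin.lastCases ?_ (fun k => ?_) k
    · simp only [Fin.snoc_last]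
      rw [tsum_eq_single b₀ fun v hv => by simp [hv]]
      -- Fixing the next-to-last label as `v` brings the sum to the form of the induction
      -- hypothesis; `hw` then does the last step.
      have hone : ∀ b : Fin (n + 1) → B,
          L b * p (Fin.last n) (a (Fin.last n).castSucc, b (Fin.last n)) (a (Fin.last (n + 1)), b₀) =
          ∑' v, (if b (Fin.last n) = v then L b else 0) *
            p (Fin.last n) (a (Fin.last n).castSucc, v) (a (Fin.last (n + 1)), b₀) := by
        intro b
        rw [tsum_eq_single (b (Fin.last n)) fun v hv => by simp [hv.symm], if_pos rfl]
      simp only [if_true]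
      rw [tsum_congr hone, ENNReal.tsum_comm]
      simp only [ENNReal.tsum_mul_right, hL, ih']
      simp only [mul_right_comm (w _), ENNReal.tsum_mul_right, hw]
      ring
    · simp only [Fin.snoc_castSucc]
      rw [ENNReal.tsum_comm, ← ih' k b₀, ← ENNReal.tsum_mul_right]
      refine tsum_congr fun b => ?_
      split_ifs
      · rw [ENNReal.tsum_mul_left, hp]
      · simp

variable [MeasurableSpace A] [MeasurableSingletonClass A]
  [MeasurableSpace B] [MeasurableSingletonClass B] [Countable B]
  {Ω' : Type*} [MeasurableSpace Ω'] {P : Measure Ω'}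
  {r : A × B → A × B → ℝ≥0∞} {r' : A → A → ℝ≥0∞} {ρ : A → ℝ≥0∞} {w : B → ℝ≥0∞}
  {Z : ℝ≥0 → Ω' → A × B}

lemma IsMarkovChain.measure_snd_eq_and_forall_fst_eq
    (hZ : IsMarkovChain P r (fun z => ρ z.1 * w z.2) Z)
    (hp : ∀ t : ℝ, 0 ≤ t → ∀ a a' b, ∑' b', transProb r t (a, b) (a', b') = transProb r' t a a')
    (hw : ∀ t : ℝ, 0 ≤ t → ∀ a a' b',
      ∑' b, w b * transProb r t (a, b) (a', b') = transProb r' t a a' * w b')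
    {n : ℕ} {t : Fin (n + 1) → ℝ≥0} (h0 : t 0 = 0) (ht : Monotone t) (a : Fin (n + 1) → A)
    (k : Fin (n + 1)) (b₀ : B) :
    P {ω | (Z (t k) ω).2 = b₀ ∧ ∀ i, (Z (t i) ω).1 = a i} = w b₀ * (ρ (a 0) *
      ∏ i : Fin n, transProb r' ((t i.succ : ℝ) - (t i.castSucc : ℝ)) (a i.castSucc) (a i.succ)) := by
  classical
  have hdiff : ∀ i : Fin n, 0 ≤ (t i.succ : ℝ) - (t i.castSucc : ℝ) := fun i =>
    sub_nonneg.2 (NNReal.coe_le_coe.2 (ht (Fin.castSucc_lt_succ (i := i)).le))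
  have h1 : ∀ i, Measurable fun ω => (Z (t i) ω).1 := fun i =>
    measurable_fst.comp (hZ.measurable (t i))
  have h2 : ∀ i, Measurable fun ω => (Z (t i) ω).2 := fun i =>
    measurable_snd.comp (hZ.measurable (t i))
  rw [mul_left_comm, ← tsum_mul_prod_eq (fun i => hp _ (hdiff i)) (fun i => hw _ (hdiff i)) a k b₀,
    ← ENNReal.tsum_mul_left, measure_eq_tsum_fiber
      (A := {ω | (Z (t k) ω).2 = b₀ ∧ ∀ i, (Z (t i) ω).1 = a i})
      ((h2 k (measurableSet_singleton b₀)).inter (measurableSet_forall_eq h1 a))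
      (measurable_pi_lambda (fun ω i => (Z (t i) ω).2) h2)]
  refine tsum_congr fun b => ?_
  split_ifs with hb
  · rw [← mul_assoc, ← hZ.fdd n t (fun i => (a i, b i)) h0 ht]
    congr 1
    ext ω
    simp only [Set.mem_ofPred_eq, Prod.ext_iff, forall_and, funext_iff]
    exact ⟨fun h => ⟨h.2.2, h.1⟩, fun h => ⟨h.2, (h.2 k).trans hb, h.1⟩⟩
  · rw [mul_zero]
    convert measure_empty (μ := P)
    refine Set.eq_empty_of_forall_notMem fun ω h => hb ?_
    rw [← h.1]
    exact h.2.1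

lemma IsMarkovChain.measure_snd_eq_and_forall_fst_eq_mul (hwt : ∑' b, w b = 1)
    (hZ : IsMarkovChain P r (fun z => ρ z.1 * w z.2) Z)
    (hp : ∀ t : ℝ, 0 ≤ t → ∀ a a' b, ∑' b', transProb r t (a, b) (a', b') = transProb r' t a a')
    (hw : ∀ t : ℝ, 0 ≤ t → ∀ a a' b',
      ∑' b, w b * transProb r t (a, b) (a', b') = transProb r' t a a' * w b')
    {n : ℕ} {t : Fin (n + 1) → ℝ≥0} (h0 : t 0 = 0) (ht : Monotone t) (a : Fin (n + 1) → A)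
    (k : Fin (n + 1)) (b₀ : B) :
    P {ω | (Z (t k) ω).2 = b₀ ∧ ∀ i, (Z (t i) ω).1 = a i} =
      w b₀ * P {ω | ∀ i, (Z (t i) ω).1 = a i} := by
  rw [measure_eq_tsum_fiber (A := {ω | ∀ i, (Z (t i) ω).1 = a i})
    (measurableSet_forall_eq (fun i => measurable_fst.comp (hZ.measurable (t i))) a)
    (measurable_snd.comp (hZ.measurable (t k)))]
  have h := hZ.measure_snd_eq_and_forall_fst_eq hp hw h0 ht a k
  simp only [Function.comp_apply, Set.mem_ofPred_eq, h, ENNReal.tsum_mul_right, hwt, one_mul]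

variable [Countable A] [IsProbabilityMeasure P]

lemma IsMarkovChain.measure_snd_eq (hwt : ∑' b, w b = 1)
    (hZ : IsMarkovChain P r (fun z => ρ z.1 * w z.2) Z)
    (hp : ∀ t : ℝ, 0 ≤ t → ∀ a a' b, ∑' b', transProb r t (a, b) (a', b') = transProb r' t a a')
    (hw : ∀ t : ℝ, 0 ≤ t → ∀ a a' b',
      ∑' b, w b * transProb r t (a, b) (a', b') = transProb r' t a a' * w b')
    (t : ℝ≥0) (b : B) : P {ω | (Z t ω).2 = b} = w b := by
  have h := hZ.measure_snd_eq_and_forall_fst_eq_mul hwt hp hw (t := ![0, t]) rfl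
    (by rw [Fin.monotone_iff_le_succ]; simp [Fin.forall_fin_succ]) (k := 1) (b₀ := b)
  have hm : Measurable fun ω (i : Fin 2) => (Z (![0, t] i) ω).1 :=
    measurable_pi_lambda _ fun i => measurable_fst.comp (hZ.measurable _)
  have e1 := measure_eq_tsum_fiber (P := P)
    ((measurable_snd.comp (hZ.measurable t)) (measurableSet_singleton b)) hm
  have e2 := measure_eq_tsum_fiber (P := P) MeasurableSet.univ hm
  rw [measure_univ] at e2
  change P {ω | (Z t ω).2 = b} = _ at e1
  rw [e1, ← mul_one (w b), e2, ← ENNReal.tsum_mul_left]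
  refine tsum_congr fun a => ?_
  simpa [funext_iff, and_comm] using h a

lemma IsMarkovChain.indepFun_snd_fst (hwt : ∑' b, w b = 1)
    (hZ : IsMarkovChain P r (fun z => ρ z.1 * w z.2) Z)
    (hp : ∀ t : ℝ, 0 ≤ t → ∀ a a' b, ∑' b', transProb r t (a, b) (a', b') = transProb r' t a a')
    (hw : ∀ t : ℝ, 0 ≤ t → ∀ a a' b',
      ∑' b, w b * transProb r t (a, b) (a', b') = transProb r' t a a' * w b')
    (t : ℝ≥0) : IndepFun (fun ω => (Z t ω).2) (fun ω (s : ℝ≥0) => (Z s ω).1) P := by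
  have h1 : ∀ t, Measurable fun ω => (Z t ω).1 := fun t => measurable_fst.comp (hZ.measurable t)
  have h2 : Measurable fun ω => (Z t ω).2 := measurable_snd.comp (hZ.measurable t)
  refine IndepFun.indepFun_process h2 h1 fun I => ?_
  classical
  -- Time `0` is needed for `fdd`, and `t` must be a sampled time; the extra coordinates are
  -- projected away at the end.
  set J : Finset ℝ≥0 := insert 0 (insert t I) with hJ
  have h0J : (0 : ℝ≥0) ∈ J := Finset.mem_insert_self _ _
  have htJ : t ∈ J := Finset.mem_insert_of_mem (Finset.mem_insert_self _ _)
  have hIJ : ∀ i : I, (i : ℝ≥0) ∈ J := fun i =>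
    Finset.mem_insert_of_mem (Finset.mem_insert_of_mem i.2)
  obtain ⟨n, hn⟩ := Nat.exists_eq_succ_of_ne_zero (Finset.card_ne_zero_of_mem h0J)
  let e := J.orderIsoOfFin hn
  have he0 : (e 0 : ℝ≥0) = 0 := by
    refine le_antisymm ?_ zero_le
    have := e.monotone (Fin.zero_le (e.symm ⟨0, h0J⟩))
    rwa [e.apply_symm_apply] at this
  have hm1 : Measurable fun ω i => (Z (e i) ω).1 := measurable_pi_lambda _ fun i => h1 _
  have key : IndepFun (fun ω => (Z t ω).2) (fun ω i => (Z (e i) ω).1) P := by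
    rw [indepFun_iff_map_prod_eq_prod_map_map h2.aemeasurable hm1.aemeasurable]
    refine Measure.ext_of_singleton fun z => ?_
    rw [← Set.singleton_prod_singleton (a := z.1) (b := z.2), Measure.prod_prod,
      Measure.map_apply (h2.prodMk hm1) ((measurableSet_singleton _).prod (measurableSet_singleton _)),
      Measure.map_apply h2 (measurableSet_singleton _),
      Measure.map_apply hm1 (measurableSet_singleton _)]
    have h := hZ.measure_snd_eq_and_forall_fst_eq_mul hwt hp hw (t := fun i => (e i : ℝ≥0)) he0
      (fun i j hij => e.monotone hij) z.2 (e.symm ⟨t, htJ⟩) z.1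
    rw [e.apply_symm_apply, ← hZ.measure_snd_eq hwt hp hw t] at h
    simpa [Set.preimage, funext_iff, Prod.ext_iff] using h
  have hφ : Measurable fun (f : Fin (n + 1) → A) (i : I) => f (e.symm ⟨i, hIJ i⟩) :=
    measurable_pi_lambda _ fun i => measurable_pi_apply _
  have := key.comp measurable_id hφ
  simpa [Function.comp_def] using this

end Independence

theorem mainTheorem7 (q : ℝ) (hq0 : 0 < q) (hq1 : q < 1) (d : ℕ) (hd : 0 < d) :
    -- the joint chain `(ξ(t), x(t))` does not explode, so that it is well defined for all times
    (∀ t : ℝ, 0 ≤ t → ∀ z, ∑' z', transProb (jointRate q d) t z z' = 1) ∧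
    -- `π` is a probability distribution
    (∑' x, labelDist q d x = 1) ∧
    -- while the background stays in a state `η`, whichever it is, `π` is reversible stationary
    (∀ η : AsepState, IsReversibleStationary (labelRate q (d := d) η) (labelDist q d)) ∧
    -- the blocking measures `μ^c` are among the reversible backgrounds of the last clause
    (∀ c : ℝ, DetailedBalance (asepRate q) (blockingMeasure q c)) ∧
    -- the process, with `x(0) ∼ π` independent of `ξ(0) ∼ ρ` for an arbitrary law `ρ`
    (∀ (ρ : PMF AsepState) {Ω' : Type*} [MeasurableSpace Ω'] (P : Measure Ω')
      [IsProbabilityMeasure P] (Z : ℝ≥0 → Ω' → AsepState × LabelState d),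
      IsMarkovChain P (jointRate q d) (fun z => ρ z.1 * labelDist q d z.2) Z →
      -- `x(t) ∼ π` at all times,
      (∀ t x, P {ω | (Z t ω).2 = x} = labelDist q d x) ∧
      -- independently of the whole background process,
      (∀ t, IndepFun (fun ω => (Z t ω).2) (fun ω (s : ℝ≥0) => (Z s ω).1) P) ∧
      -- and if the background is reversible, then `x` is a stationary and reversible process,
      -- also jointly with the background
      (DetailedBalance (asepRate q) ρ →
        (IsStationaryProcess P (fun t ω => (Z t ω).2) ∧
          IsReversibleProcess P (fun t ω => (Z t ω).2)) ∧
        (IsStationaryProcess P Z ∧ IsReversibleProcess P Z))) := by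
  refine ⟨fun t ht z => tsum_transProb_jointRate hq1 hd ht z, tsum_labelDist hq0 hq1 d,
    isReversibleStationary_labelDist hq0 hq1 hd, detailedBalance_blockingMeasure hq0 hq1, ?_⟩
  intro ρ Ω' _ P _ Z hZ
  have hp : ∀ t : ℝ, 0 ≤ t → ∀ η η' (x : LabelState d),
      ∑' x', transProb (jointRate q d) t (η, x) (η', x') = transProb (asepRate q) t η η' :=
    fun t ht => tsum_transProb_jointRate_snd hq1 hd ht
  have hw : ∀ t : ℝ, 0 ≤ t → ∀ η η' (x' : LabelState d),
      ∑' x, labelDist q d x * transProb (jointRate q d) t (η, x) (η', x') =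
        transProb (asepRate q) t η η' * labelDist q d x' :=
    fun t ht => tsum_labelDist_mul_transProb hq0 hq1 hd ht
  have hone := tsum_labelDist hq0 hq1 d
  refine ⟨hZ.measure_snd_eq hone hp hw, hZ.indepFun_snd_fst hone hp hw, fun hρ => ?_⟩
  have hb : DetailedBalance (jointRate q d) fun z => ρ z.1 * labelDist q d z.2 := hρ.jointRate hq0
  have hm := fun t (ht : (0 : ℝ) ≤ t) => hb.tsum_mul_transProb ht (tsum_transProb_jointRate hq1 hd ht)
  have hstat := hZ.isStationaryProcess hm
  have hrev := hZ.isReversibleProcess hm hb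
  -- The label process is treated as a measurable image of the pair, without any Markov property of
  -- its own.
  refine ⟨⟨fun s => ?_, fun T => ?_⟩, hstat, hrev⟩
  · exact (hstat s).comp (u := fun f t => (f t).2)
      (measurable_pi_lambda _ fun t => measurable_snd.comp (measurable_pi_apply t))
  · exact (hrev T).comp (u := fun f t => (f t).2)
      (measurable_pi_lambda _ fun t => measurable_snd.comp (measurable_pi_apply t))
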